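/- For real numbers $a,c\ge 1$ and an integer $n\ge 1$ let $A=A(a,c,n)$ be the real symmetric tridiagonal $n\times n$ matrix whose entries next to the diagonal are all equal to $1$ and whose diagonal entries are $A_j = 2+(j/c)^a$, $j=1,\dots,n$. By the normalized eigenvector of a matrix for a given eigenvalue we mean the eigenvector of Euclidean length $1$ whose first coordinate is positive. **Theorem.** Let $a\ge 1$ and $L$ be real numbers. There are constants $C>0$ and $c_0\ge 1$, depending only on $a$ and $L$, such that the following holds for every real $c\ge c_0$, all integers $1\le k\le n$, and every eigenvalue $\lambda$ of $A=A(a,c,n)$ with $$2+A_k<\lambda\le L .$$ Let $X=(X_1,\dots,X_n)$ be the normalized eigenvector of $A$ for $\lambda$. Let $\varepsilon>0$ satisfy $C\,\varepsilon\, c^{4a/(a+2)}\le 1$, and let $A'$ be any real symmetric $n\times n$ matrix whose entries agree with those of $A$ to relative precision $\varepsilon$, i.e. $|A'_{ij}-A_{ij}|\le\varepsilon\,|A_{ij}|$ for all $i,j$. Let $\lambda'$ be the eigenvalue of $A'$ that has the same position as $\lambda$ when the eigenvalues of either matrix are listed in order, with multiplicity. Then $A'$ has a normalized eigenvector for $\lambda'$,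 and every such eigenvector $X'$ satisfies, for every $j=1,\dots,k$, $$X_j\neq 0,\qquad \left|\frac{X'_j-X_j}{X_j}\right|\le \varepsilon\cdot C\,c^{4a/(a+2)} .$$ That is, $X_1,\dots,X_k$ are determined by the entries of $A$ to relative precision $\varepsilon\cdot O\!\left(c^{4a/(a+2)}\right)$ as $c\to\infty$, for fixed $a$ and uniformly over $n$, $k$ and over the eigenvalues in a bounded range. The bound does not depend on how small the coordinates $X_1,\dots,X_k$ are. -/

import Mathlib

/-- The diagonal entry `A_j = 2 + (j / c) ^ a` (with `j` counted from `1`). -/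
noncomputable def diagEntry (a c : ℝ) (j : ℕ) : ℝ := 2 + ((j : ℝ) / c) ^ a

/-- The `n × n` symmetric tridiagonal matrix with diagonal entries `A_1, …, A_n` and unit
off-diagonal entries. The index `i : Fin n` stands for the `(i + 1)`-st row or column. -/
noncomputable def tridiag (a c : ℝ) (n : ℕ) : Matrix (Fin n) (Fin n) ℝ :=
  Matrix.of fun i j =>
    if i = j then diagEntry a c ((i : ℕ) + 1)
    else if (i : ℕ) + 1 = (j : ℕ) ∨ (j : ℕ) + 1 = (i : ℕ) then 1
    else 0

/-- `X` is the eigenvector of `M` for the eigenvalue `lam` in the usual normalization: it has unit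
Euclidean length, and its first coordinate is positive. -/
structure IsNormalizedEigenvector {n : ℕ} (M : Matrix (Fin n) (Fin n) ℝ) (lam : ℝ)
    (X : Fin n → ℝ) : Prop where
  mulVec_eq : M.mulVec X = lam • X
  unit_length : ∑ i, X i ^ 2 = 1
  first_pos : ∀ i : Fin n, (i : ℕ) = 0 → 0 < X i

/-- `lam` and `mu` are eigenvalues of the real symmetric matrices `M` and `N` that occupy the same
position when the eigenvalues of either matrix are listed in order, with multiplicity. -/
def CorrespondingEigenvalues {n : ℕ} (M N : Matrix (Fin n) (Fin n) ℝ) (lam mu : ℝ) : Prop :=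
  ∃ (hM : M.IsHermitian) (hN : N.IsHermitian) (i : Fin (Fintype.card (Fin n))),
    hM.eigenvalues₀ i = lam ∧ hN.eigenvalues₀ i = mu

/-- The entries of `M` and `N` agree to the relative precision `ε`: each entry of `N` has relative
error at most `ε` as an approximation to the entry of `M` (zero entries agree exactly). -/
def EntriesAgreeTo {n : ℕ} (ε : ℝ) (M N : Matrix (Fin n) (Fin n) ℝ) : Prop :=
  ∀ i j, |N i j - M i j| ≤ ε * |M i j|

open Finset

/-- A comparison of quadratic forms of symmetric operators yields the same comparison of their
ordered eigenvalues (Courant–Fischer). -/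
theorem LinearMap.IsSymmetric.eigenvalues_le_of_inner_le {E : Type*} [NormedAddCommGroup E]
    [InnerProductSpace ℝ E] [FiniteDimensional ℝ E] {N : ℕ} (hN : Module.finrank ℝ E = N)
    {S T : E →ₗ[ℝ] E} (hS : S.IsSymmetric) (hT : T.IsSymmetric) {s t : ℝ} (hs : 0 ≤ s)
    (h : ∀ x, inner ℝ x (S x) ≤ s * inner ℝ x (T x) + t * ‖x‖ ^ 2) (i : Fin N) :
    hS.eigenvalues hN i ≤ s * hT.eigenvalues hN i + t := by
  set b := hS.eigenvectorBasis hN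
  set d := hT.eigenvectorBasis hN
  have form : ∀ (U : E →ₗ[ℝ] E) (hU : U.IsSymmetric) (x : E), inner ℝ x (U x) =
      ∑ j, hU.eigenvalues hN j * inner ℝ (hU.eigenvectorBasis hN j) x ^ 2 := by
    intro U hU x
    rw [← (hU.eigenvectorBasis hN).sum_inner_mul_inner x (U x)]
    refine Finset.sum_congr rfl fun j _ => ?_
    rw [← hU, hU.apply_eigenvectorBasis hN, real_inner_comm]
    simp only [inner_smul_left]
    simp
    ring
  have norm_form : ∀ (e : OrthonormalBasis (Fin N) ℝ E) (x : E),
      ‖x‖ ^ 2 = ∑ j, inner ℝ (e j) x ^ 2 := by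
    intro e x
    rw [← e.sum_sq_norm_inner_right x]
    simp
  let φ : E →ₗ[ℝ] ({j : Fin N // j ≠ i} → ℝ) := LinearMap.pi fun j =>
    if (j : Fin N) < i then (innerSL ℝ (d j)).toLinearMap else (innerSL ℝ (b j)).toLinearMap
  have hker : LinearMap.ker φ ≠ ⊥ := by
    apply LinearMap.ker_ne_bot_of_finrank_lt
    have := i.2
    simp [hN]
    omega
  obtain ⟨x, hx, hx0⟩ := Submodule.exists_mem_ne_zero_of_ne_bot hker
  have hx' : ∀ j : Fin N, j ≠ i →
      (if j < i then (innerSL ℝ (d j)).toLinearMap else (innerSL ℝ (b j)).toLinearMap) x = 0 := by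
    intro j hj
    exact congrFun (LinearMap.mem_ker.1 hx) ⟨j, hj⟩
  have hd : ∀ j, j < i → inner ℝ (d j) x = 0 := by
    intro j hj
    simpa [hj] using hx' j hj.ne
  have hb : ∀ j, i < j → inner ℝ (b j) x = 0 := by
    intro j hj
    simpa [hj.not_gt] using hx' j hj.ne'
  have h1 : hS.eigenvalues hN i * ‖x‖ ^ 2 ≤ inner ℝ x (S x) := by
    rw [form S hS, norm_form b, Finset.mul_sum]
    refine Finset.sum_le_sum fun j _ => ?_
    rcases lt_or_ge i j with hj | hj
    · have := hb j hj
      simp only [b] at this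
      simp [b, this]
    · exact mul_le_mul_of_nonneg_right (hS.eigenvalues_antitone hN hj) (sq_nonneg _)
  have h2 : inner ℝ x (T x) ≤ hT.eigenvalues hN i * ‖x‖ ^ 2 := by
    rw [form T hT, norm_form d, Finset.mul_sum]
    refine Finset.sum_le_sum fun j _ => ?_
    rcases lt_or_ge j i with hj | hj
    · have := hd j hj
      simp only [d] at this
      simp [d, this]
    · exact mul_le_mul_of_nonneg_right (hT.eigenvalues_antitone hN hj) (sq_nonneg _)
  have hpos : 0 < ‖x‖ ^ 2 := by positivity
  have h3 := h x
  have h4 := mul_le_mul_of_nonneg_left h2 hs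
  exact le_of_mul_le_mul_right (by linarith : _ * ‖x‖ ^ 2 ≤ _ * ‖x‖ ^ 2) hpos

/-- The matrix form of `LinearMap.IsSymmetric.eigenvalues_le_of_inner_le`. -/
theorem Matrix.IsHermitian.eigenvalues₀_le_of_dotProduct_le {n : Type*} [Fintype n] [DecidableEq n]
    {M N : Matrix n n ℝ} (hM : M.IsHermitian) (hN : N.IsHermitian) {s t : ℝ} (hs : 0 ≤ s)
    (h : ∀ x : n → ℝ, x ⬝ᵥ M.mulVec x ≤ s * (x ⬝ᵥ N.mulVec x) + t * ∑ i, x i ^ 2)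
    (i : Fin (Fintype.card n)) : hM.eigenvalues₀ i ≤ s * hN.eigenvalues₀ i + t := by
  apply LinearMap.IsSymmetric.eigenvalues_le_of_inner_le
  · exact hs
  · intro x
    have := h x.ofLp
    rw [EuclideanSpace.norm_sq_eq]
    simpa [EuclideanSpace.inner_eq_star_dotProduct, Matrix.toLpLin_apply, dotProduct_comm]
      using this

/-- The entries of a vector of length `n`, counted from `1` and continued by zeros. -/
def zeroExtend {n : ℕ} (X : Fin n → ℝ) : ℕ → ℝ
  | 0 => 0
  | j + 1 => if h : j < n then X ⟨j, h⟩ else 0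

@[simp] theorem zeroExtend_zero {n : ℕ} (X : Fin n → ℝ) : zeroExtend X 0 = 0 := rfl

theorem zeroExtend_succ {n : ℕ} (X : Fin n → ℝ) (i : Fin n) : zeroExtend X (i + 1) = X i := by
  simp [zeroExtend]

theorem zeroExtend_of_lt {n : ℕ} (X : Fin n → ℝ) {j : ℕ} (hj : n < j) : zeroExtend X j = 0 := by
  obtain ⟨i, rfl⟩ : ∃ i, j = i + 1 := ⟨j - 1, by omega⟩
  have : ¬ i < n := by omega
  simp [zeroExtend, this]

theorem sum_range_zeroExtend_sq {n : ℕ} (X : Fin n → ℝ) :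
    ∑ j ∈ range (n + 1), zeroExtend X j ^ 2 = ∑ i, X i ^ 2 := by
  rw [Finset.sum_range_succ', Finset.sum_range]
  simp [zeroExtend_succ]

/-- `M` is the symmetric tridiagonal matrix with diagonal entries `d 1, …, d n` and entries
`e 1, …, e (n - 1)` next to the diagonal. -/
def IsJacobi {n : ℕ} (M : Matrix (Fin n) (Fin n) ℝ) (d e : ℕ → ℝ) : Prop :=
  ∀ i j : Fin n, M i j = if (i : ℕ) = j then d (i + 1) else if (i : ℕ) + 1 = j then e (i + 1)
    else if (j : ℕ) + 1 = i then e i else 0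

theorem IsJacobi.mulVec_apply {n : ℕ} {M : Matrix (Fin n) (Fin n) ℝ} {d e : ℕ → ℝ}
    (hM : IsJacobi M d e) (X : Fin n → ℝ) (i : Fin n) :
    M.mulVec X i = e (i + 1) * zeroExtend X (i + 2) + e i * zeroExtend X i
      + d (i + 1) * zeroExtend X (i + 1) := by
  have key : ∀ (k : ℕ) (z : ℝ), ∑ j : Fin n, (if (j : ℕ) + 1 = k then z * zeroExtend X k else 0)
      = z * zeroExtend X k := by
    intro k z
    by_cases hk : 1 ≤ k ∧ k ≤ n
    · rw [Finset.sum_eq_single (⟨k - 1, by omega⟩ : Fin n)]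
      · simp; intro h; omega
      · intro j _ hj
        rw [if_neg]
        intro h
        apply hj
        ext
        simp
        omega
      · simp
    · have : zeroExtend X k = 0 := by
        rcases Nat.eq_zero_or_pos k with rfl | h
        · rfl
        · exact zeroExtend_of_lt X (by omega)
      simp [this]
  rw [← key (i + 2) (e (i + 1)), ← key i (e i), ← key (i + 1) (d (i + 1)), ← sum_add_distrib,
    ← sum_add_distrib]
  change ∑ j, M i j * X j = _
  refine Finset.sum_congr rfl fun j _ => ?_
  rw [hM i j, ← zeroExtend_succ X j]
  have hi := i.2
  have hj := j.2
  by_cases h1 : (i : ℕ) = j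
  · rw [if_pos h1, if_neg (by omega), if_neg (by omega), if_pos (by omega), h1]
    ring
  · by_cases h2 : (i : ℕ) + 1 = j
    · rw [if_neg h1, if_pos h2, if_pos (by omega), if_neg (by omega), if_neg (by omega), ← h2]
      ring
    · by_cases h3 : (j : ℕ) + 1 = i
      · rw [if_neg h1, if_neg h2, if_pos h3, if_neg (by omega), if_pos (by omega),
          if_neg (by omega), h3]
        ring
      · rw [if_neg h1, if_neg h2, if_neg h3, if_neg (by omega), if_neg (by omega),
          if_neg (by omega)]
        ring

/-- The eigenvalue equation of a Jacobi matrix as a three-term recurrence. -/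
theorem IsJacobi.recurrence {n : ℕ} {M : Matrix (Fin n) (Fin n) ℝ} {d e : ℕ → ℝ}
    (hM : IsJacobi M d e) {X : Fin n → ℝ} {lam : ℝ} (hX : M.mulVec X = lam • X) {j : ℕ}
    (hj : j < n) : e (j + 1) * zeroExtend X (j + 2) + e j * zeroExtend X j
      + d (j + 1) * zeroExtend X (j + 1) = lam * zeroExtend X (j + 1) := by
  have h1 := hM.mulVec_apply X ⟨j, hj⟩
  have h2 := zeroExtend_succ X ⟨j, hj⟩
  rw [hX] at h1
  simp only [Pi.smul_apply, smul_eq_mul] at h1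
  rw [← h1]
  exact congrArg (lam * ·) h2.symm

theorem isJacobi_tridiag (a c : ℝ) (n : ℕ) :
    IsJacobi (tridiag a c n) (diagEntry a c) (fun _ => 1) := by
  intro i j
  simp only [tridiag, Matrix.of_apply, Fin.ext_iff]
  split_ifs <;> first | rfl | omega

theorem isSymm_tridiag (a c : ℝ) (n : ℕ) : (tridiag a c n).IsSymm := by
  ext i j
  rw [Matrix.transpose_apply, isJacobi_tridiag a c n, isJacobi_tridiag a c n]
  by_cases h : (i : ℕ) = j
  · rw [h]
  · rw [if_neg h, if_neg (Ne.symm h)]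
    split_ifs <;> rfl

theorem two_le_diagEntry (a : ℝ) {c : ℝ} (hc : 0 ≤ c) (j : ℕ) : 2 ≤ diagEntry a c j := by
  have : 0 ≤ ((j : ℝ) / c) ^ a := by positivity
  unfold diagEntry
  linarith

/-- Coordinatewise relative perturbations of `tridiag a c n` are Jacobi matrices. -/
theorem EntriesAgreeTo.exists_isJacobi {a c ε : ℝ} (hc : 0 ≤ c) (hε : 0 ≤ ε) {n : ℕ}
    {A' : Matrix (Fin n) (Fin n) ℝ} (hs : A'.IsSymm) (h : EntriesAgreeTo ε (tridiag a c n) A') :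
    ∃ d e : ℕ → ℝ, IsJacobi A' d e ∧ (∀ j, |d j - diagEntry a c j| ≤ ε * diagEntry a c j) ∧
      ∀ j, |e j - 1| ≤ ε := by
  have hA := isJacobi_tridiag a c n
  refine ⟨fun j => if h : 1 ≤ j ∧ j ≤ n then A' ⟨j - 1, by omega⟩ ⟨j - 1, by omega⟩
    else diagEntry a c j, fun j => if h : 1 ≤ j ∧ j + 1 ≤ n then A' ⟨j - 1, by omega⟩ ⟨j, by omega⟩
    else 1, ?_, ?_, ?_⟩
  · intro i j
    have hi := i.2
    have hj := j.2
    by_cases h1 : (i : ℕ) = j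
    · have : i = j := Fin.ext h1
      subst this
      simp
    · by_cases h2 : (i : ℕ) + 1 = j
      · beta_reduce
        rw [if_neg h1, if_pos h2, dif_pos (by omega)]
        congr 1
        exact Fin.ext h2.symm
      · by_cases h3 : (j : ℕ) + 1 = i
        · beta_reduce
          rw [if_neg h1, if_neg h2, if_pos h3, dif_pos (by omega), ← hs.apply i j]
          congr 1
          exact Fin.ext (by simp; omega)
        · rw [if_neg h1, if_neg h2, if_neg h3]
          have := h i j
          rw [hA, if_neg h1, if_neg h2, if_neg h3] at this
          simpa using this
  · intro j
    have h2 := two_le_diagEntry a hc j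
    by_cases hj : 1 ≤ j ∧ j ≤ n
    · have := h ⟨j - 1, by omega⟩ ⟨j - 1, by omega⟩
      rw [hA, if_pos rfl] at this
      simp only at this
      rw [Nat.sub_add_cancel hj.1, abs_of_nonneg (by linarith : (0 : ℝ) ≤ diagEntry a c j)] at this
      beta_reduce
      rw [dif_pos hj]
      exact this
    · beta_reduce
      rw [dif_neg hj]
      simp
      positivity
  · intro j
    by_cases hj : 1 ≤ j ∧ j + 1 ≤ n
    · have := h ⟨j - 1, by omega⟩ ⟨j, by omega⟩
      rw [hA, if_neg (by simp; omega), if_pos (by simp; omega)] at this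
      beta_reduce
      rw [dif_pos hj]
      simpa using this
    · beta_reduce
      rw [dif_neg hj]
      simpa using hε

theorem abs_form_le {a c : ℝ} (hc : 0 ≤ c) {n : ℕ} (x : Fin n → ℝ) :
    ∑ i, ∑ j, |tridiag a c n i j| * |x i| * |x j|
      ≤ x ⬝ᵥ (tridiag a c n).mulVec x + 4 * ∑ i, x i ^ 2 := by
  have hA := isJacobi_tridiag a c n
  have hcard : ∀ i : Fin n, ∑ j : Fin n,
      ((if (i : ℕ) + 1 = j then (1 : ℝ) else 0) + if (j : ℕ) + 1 = i then 1 else 0) ≤ 2 := by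
    intro i
    rw [sum_add_distrib, Finset.sum_boole, Finset.sum_boole]
    have h1 : #{j : Fin n | (i : ℕ) + 1 = j} ≤ 1 :=
      card_le_one.2 fun p hp q hq => Fin.ext (by simp at hp hq; omega)
    have h2 : #{j : Fin n | (j : ℕ) + 1 = i} ≤ 1 :=
      card_le_one.2 fun p hp q hq => Fin.ext (by simp at hp hq; omega)
    have h1' : (#{j : Fin n | (i : ℕ) + 1 = j} : ℝ) ≤ 1 := by exact_mod_cast h1
    have h2' : (#{j : Fin n | (j : ℕ) + 1 = i} : ℝ) ≤ 1 := by exact_mod_cast h2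
    linarith
  set adj : Fin n → Fin n → ℝ := fun i j =>
    (if (i : ℕ) + 1 = j then (1 : ℝ) else 0) + if (j : ℕ) + 1 = i then 1 else 0 with hadj
  have hsymm : ∀ i j, adj i j = adj j i := fun i j => by simp [hadj, add_comm]
  have hpt : ∀ i j, |tridiag a c n i j| * |x i| * |x j|
      ≤ x i * (tridiag a c n i j * x j) + (adj i j * x i ^ 2 + adj i j * x j ^ 2) := by
    intro i j
    rw [hA]
    have h2 := two_le_diagEntry a hc (i + 1)
    by_cases h1 : (i : ℕ) = j
    · have : i = j := Fin.ext h1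
      subst this
      simp only [if_true, hadj]
      rw [if_neg (by omega), abs_of_nonneg (by linarith)]
      nlinarith [abs_mul_abs_self (x i)]
    · have hxx : |x i| * |x j| ≤ x i * x j + (x i ^ 2 + x j ^ 2) := by
        rw [← abs_mul]
        rcases abs_cases (x i * x j) with h | h <;> nlinarith [sq_nonneg (x i), sq_nonneg (x j),
          sq_nonneg (x i + x j)]
      by_cases h3 : (i : ℕ) + 1 = j
      · simp only [hadj]
        rw [if_neg h1, if_pos h3, if_pos h3, if_neg (by omega)]
        simp
        linarith
      · by_cases h4 : (j : ℕ) + 1 = i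
        · simp only [hadj]
          rw [if_neg h1, if_neg h3, if_pos h4]
          simp [h3]
          linarith
        · simp [hadj, h1, h3, h4]
  have hsum1 : ∑ i, ∑ j, adj i j * x i ^ 2 ≤ 2 * ∑ i, x i ^ 2 := by
    rw [mul_sum]
    refine sum_le_sum fun i _ => ?_
    rw [← sum_mul]
    exact mul_le_mul_of_nonneg_right (hcard i) (sq_nonneg _)
  have hsum2 : ∑ i, ∑ j, adj i j * x j ^ 2 = ∑ i, ∑ j, adj i j * x i ^ 2 := by
    rw [sum_comm]
    simp_rw [hsymm]
  calc _ ≤ ∑ i, ∑ j, (x i * (tridiag a c n i j * x j) + (adj i j * x i ^ 2 + adj i j * x j ^ 2)) :=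
        sum_le_sum fun i _ => sum_le_sum fun j _ => hpt i j
    _ = x ⬝ᵥ (tridiag a c n).mulVec x + (∑ i, ∑ j, adj i j * x i ^ 2 + ∑ i, ∑ j, adj i j * x j ^ 2)
        := by
        simp only [sum_add_distrib, dotProduct, Matrix.mulVec, mul_sum]
    _ ≤ _ := by linarith

/-- Corresponding eigenvalues of `tridiag a c n` and a coordinatewise relative perturbation. -/
theorem abs_sub_le_of_correspondingEigenvalues {a c ε lam lam' : ℝ} (hc : 0 ≤ c) (hε : 0 ≤ ε)
    (hε1 : ε < 1) {n : ℕ} {A' : Matrix (Fin n) (Fin n) ℝ}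
    (h : EntriesAgreeTo ε (tridiag a c n) A')
    (hl : CorrespondingEigenvalues (tridiag a c n) A' lam lam') :
    |lam' - lam| ≤ ε * (lam + 4) := by
  obtain ⟨hM, hN, i, rfl, rfl⟩ := hl
  have hdiff : ∀ x : Fin n → ℝ, |x ⬝ᵥ A'.mulVec x - x ⬝ᵥ (tridiag a c n).mulVec x| ≤
      ε * (x ⬝ᵥ (tridiag a c n).mulVec x + 4 * ∑ i, x i ^ 2) := by
    intro x
    calc _ = |∑ i, ∑ j, x i * ((A' i j - tridiag a c n i j) * x j)| := by
          simp only [dotProduct, Matrix.mulVec, mul_sum, ← sum_sub_distrib]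
          congr 1
          refine sum_congr rfl fun i _ => sum_congr rfl fun j _ => by ring
      _ ≤ ∑ i, ∑ j, |x i * ((A' i j - tridiag a c n i j) * x j)| :=
          (abs_sum_le_sum_abs _ _).trans (sum_le_sum fun i _ => abs_sum_le_sum_abs _ _)
      _ ≤ ∑ i, ∑ j, ε * (|tridiag a c n i j| * |x i| * |x j|) := by
          refine sum_le_sum fun i _ => sum_le_sum fun j _ => ?_
          rw [abs_mul, abs_mul]
          have := mul_le_mul_of_nonneg_right (h i j) (mul_nonneg (abs_nonneg (x i))
            (abs_nonneg (x j)))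
          nlinarith
      _ ≤ _ := by
          simp only [← mul_sum]
          exact mul_le_mul_of_nonneg_left (abs_form_le hc x) hε
  have h1 := hN.eigenvalues₀_le_of_dotProduct_le hM (s := 1 + ε) (t := 4 * ε) (by linarith)
    (fun x => by nlinarith [(abs_le.1 (hdiff x)).2]) i
  have hpos : 0 < 1 - ε := by linarith
  have h2 := hM.eigenvalues₀_le_of_dotProduct_le hN (s := (1 - ε)⁻¹) (t := (1 - ε)⁻¹ * (4 * ε))
    (by positivity) (fun x => by
      rw [mul_assoc, ← mul_add, inv_mul_eq_div, le_div_iff₀ hpos]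
      nlinarith [(abs_le.1 (hdiff x)).1]) i
  rw [← mul_add, inv_mul_eq_div, le_div_iff₀ hpos] at h2
  rw [abs_le]
  constructor <;> linarith

theorem IsJacobi.first_ne_zero {n : ℕ} {M : Matrix (Fin n) (Fin n) ℝ} {d e : ℕ → ℝ}
    (hM : IsJacobi M d e) (he : ∀ j, e j ≠ 0) {X : Fin n → ℝ} {lam : ℝ}
    (hX : M.mulVec X = lam • X) (hX0 : X ≠ 0) : zeroExtend X 1 ≠ 0 := by
  intro h1
  have : ∀ j, j ≤ n → zeroExtend X j = 0 ∧ zeroExtend X (j + 1) = 0 := by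
    intro j
    induction j with
    | zero => exact fun _ => ⟨rfl, h1⟩
    | succ j ih =>
      intro hj
      obtain ⟨h2, h3⟩ := ih (by omega)
      have := hM.recurrence hX (j := j) (by omega)
      rw [h2, h3] at this
      refine ⟨h3, ?_⟩
      simpa [he (j + 1)] using this
  apply hX0
  funext i
  rw [← zeroExtend_succ X i]
  exact (this i i.2.le).2

/-- A normalized eigenvector exists for each eigenvalue of a Jacobi matrix with nonzero entries
next to the diagonal. -/
theorem IsJacobi.exists_isNormalizedEigenvector {n : ℕ} {M : Matrix (Fin n) (Fin n) ℝ}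
    {d e : ℕ → ℝ} (hM : IsJacobi M d e) (he : ∀ j, e j ≠ 0) (hH : M.IsHermitian)
    (i : Fin (Fintype.card (Fin n))) :
    ∃ X, IsNormalizedEigenvector M (hH.eigenvalues₀ i) X := by
  set k : Fin n := Fintype.equivOfCardEq (Fintype.card_fin _) i with hk
  have hlam : hH.eigenvalues k = hH.eigenvalues₀ i := by
    simp [Matrix.IsHermitian.eigenvalues, hk]
  set X : Fin n → ℝ := ⇑(hH.eigenvectorBasis k) with hXdef
  have hX : M.mulVec X = hH.eigenvalues₀ i • X := by
    rw [← hlam]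
    exact hH.mulVec_eigenvectorBasis k
  have hnorm : ∑ i, X i ^ 2 = 1 := by
    have := hH.eigenvectorBasis.orthonormal.1 k
    have h2 : ‖hH.eigenvectorBasis k‖ ^ 2 = 1 := by rw [this]; norm_num
    rw [EuclideanSpace.norm_sq_eq] at h2
    simpa using h2
  have hX0 : X ≠ 0 := by
    intro h
    simp [h] at hnorm
  have hfirst := hM.first_ne_zero he hX hX0
  rcases lt_or_gt_of_ne hfirst with h | h
  · refine ⟨-X, ?_, ?_, ?_⟩
    · rw [Matrix.mulVec_neg, hX, smul_neg]
    · simpa using hnorm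
    · intro j hj
      have h3 := zeroExtend_succ X j
      rw [hj] at h3
      simp only [zero_add] at h3
      simp only [Pi.neg_apply]
      linarith
  · refine ⟨X, hX, hnorm, ?_⟩
    intro j hj
    have h3 := zeroExtend_succ X j
    rw [hj] at h3
    simp only [zero_add] at h3
    linarith

theorem Matrix.IsHermitian.exists_eigenvalues₀_eq {n : ℕ} {M : Matrix (Fin n) (Fin n) ℝ}
    (hM : M.IsHermitian) {lam : ℝ} {X : Fin n → ℝ} (hX : M.mulVec X = lam • X) (hX0 : X ≠ 0) :
    ∃ i, hM.eigenvalues₀ i = lam := by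
  have h1 : Module.End.HasEigenvalue (Matrix.toLin' M) lam := by
    apply Module.End.hasEigenvalue_of_hasEigenvector (x := X)
    rw [Module.End.hasEigenvector_iff, Module.End.mem_eigenspace_iff]
    exact ⟨by simpa using hX, hX0⟩
  have h2 : lam ∈ spectrum ℝ M := by
    rw [← Matrix.spectrum_toLin']
    exact h1.mem_spectrum
  rw [hM.spectrum_real_eq_range_eigenvalues] at h2
  obtain ⟨k, hk⟩ := h2
  exact ⟨_, hk⟩

/-- The inhomogeneous three-term recurrence `y (j + 1) + y (j - 1) = (2 + μ - V j) y j + f j` at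
`j = 1, …, n`. -/
def SolvesUpTo (V : ℕ → ℝ) (μ : ℝ) (y f : ℕ → ℝ) (n : ℕ) : Prop :=
  ∀ j < n, y (j + 2) + y j = (2 + μ - V (j + 1)) * y (j + 1) + f (j + 1)

/-- The discrete energy of a solution of the recurrence. -/
def energy (V : ℕ → ℝ) (μ : ℝ) (y : ℕ → ℝ) (j : ℕ) : ℝ :=
  y j ^ 2 + y (j + 1) ^ 2 - (2 + μ - V j) * (y j * y (j + 1))

theorem energy_succ {V y f : ℕ → ℝ} {μ : ℝ} {j : ℕ}
    (h : y (j + 2) + y j = (2 + μ - V (j + 1)) * y (j + 1) + f (j + 1)) :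
    energy V μ y (j + 1) = y j ^ 2 + y (j + 1) ^ 2 - (2 + μ - V (j + 1)) * (y j * y (j + 1))
      + f (j + 1) * (y (j + 2) - y j) := by
  have hf : f (j + 1) = y (j + 2) + y j - (2 + μ - V (j + 1)) * y (j + 1) := by linarith
  rw [hf]
  unfold energy
  ring

theorem energy_le {V y : ℕ → ℝ} {μ : ℝ} {j : ℕ} (h1 : μ ≤ V j) (h2 : V j ≤ μ + 4) :
    energy V μ y j ≤ 2 * (y j ^ 2 + y (j + 1) ^ 2) := by
  unfold energy
  nlinarith [mul_nonneg (sub_nonneg.2 h1) (sq_nonneg (y j - y (j + 1))),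
    mul_nonneg (sub_nonneg.2 h2) (sq_nonneg (y j + y (j + 1)))]

/-- Where `V ≥ μ`, the quotient of the energy by `V - μ` decreases along homogeneous solutions. -/
theorem energy_mul_le {V y : ℕ → ℝ} {μ : ℝ} {J m : ℕ} (hV : Monotone V) (hJ : μ < V J)
    (hJm : J ≤ m) (hy : SolvesUpTo V μ y 0 m) :
    energy V μ y m * (V J - μ) ≤ energy V μ y J * (V m - μ) := by
  induction m, hJm using Nat.le_induction with
  | base => exact le_rfl
  | succ m hJm ih =>
    have ih := ih fun j hj => hy j (by omega)
    have h1 := hV hJm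
    have h2 := hV (Nat.le_succ m)
    simp only [Nat.succ_eq_add_one] at h2
    have h3 : energy V μ y (m + 1) * (V m - μ) ≤ energy V μ y m * (V (m + 1) - μ) := by
      rw [energy_succ (hy m (by omega))]
      simp only [Pi.zero_apply, zero_mul, add_zero]
      unfold energy
      nlinarith [mul_nonneg (sub_nonneg.2 h2) (sq_nonneg (y m - y (m + 1)))]
    have hm : 0 < V m - μ := by linarith
    refine le_of_mul_le_mul_right ?_ hm
    have h4 := mul_le_mul_of_nonneg_right h3 (sub_nonneg.2 hJ.le)
    have h5 := mul_le_mul_of_nonneg_right ih (by linarith : 0 ≤ V (m + 1) - μ)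
    linarith

/-- A virial estimate on the side of the recurrence where `V ≤ μ + 2`. -/
theorem sum_mul_sq_le_of_le {V y f : ℕ → ℝ} {μ B : ℝ} {m : ℕ} (hV : Monotone V) (hV0 : 0 ≤ V 0)
    (hB : 3 + μ ≤ B) (hm1 : μ ≤ V m) (hm2 : V m ≤ μ + 2) (hy0 : y 0 = 0)
    (hy : SolvesUpTo V μ y f m) :
    ∑ j ∈ range m, (V (j + 1) - V j) * (y j ^ 2 + y (j + 1) ^ 2) ≤
      2 * B ^ 2 * (2 * (y m ^ 2 + y (m + 1) ^ 2)
        + ∑ j ∈ range m, |f (j + 1)| * |y (j + 2) - y j|) := by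
  set g : ℕ → ℝ := fun j => (3 + μ - V j)⁻¹ with hg
  have hden : ∀ j ≤ m, 1 ≤ 3 + μ - V j ∧ 3 + μ - V j ≤ B := fun j hj =>
    ⟨by linarith [hV hj], by linarith [hV (Nat.zero_le j)]⟩
  have hB1 : 1 ≤ B := by linarith [hden m le_rfl]
  have key : ∀ k ≤ m, (∑ j ∈ range k, (V (j + 1) - V j) * (y j ^ 2 + y (j + 1) ^ 2)) / (2 * B ^ 2)
      ≤ g k * energy V μ y k + ∑ j ∈ range k, |f (j + 1)| * |y (j + 2) - y j| := by
    intro k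
    induction k with
    | zero =>
      intro _
      have := hden 0 (Nat.zero_le _)
      simp only [range_zero, sum_empty, zero_div, add_zero, energy, hy0, hg]
      have : 0 ≤ (3 + μ - V 0)⁻¹ := inv_nonneg.2 (by linarith)
      simp
      positivity
    | succ k ih =>
      intro hk
      have ih := ih (by omega)
      obtain ⟨h1, h2⟩ := hden k (by omega)
      obtain ⟨h3, h4⟩ := hden (k + 1) hk
      have hVk : V k ≤ V (k + 1) := hV (Nat.le_succ k)
      have hgk : g k * (3 + μ - V k) = 1 := inv_mul_cancel₀ (by linarith)
      have hgk1 : g (k + 1) * (3 + μ - V (k + 1)) = 1 := inv_mul_cancel₀ (by linarith)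
      have hgpos : 0 ≤ g (k + 1) := inv_nonneg.2 (by linarith)
      have hg1 : g (k + 1) ≤ 1 := inv_le_one_of_one_le₀ h3
      have hdg : (V (k + 1) - V k) / B ^ 2 ≤ g (k + 1) - g k := by
        have : g (k + 1) - g k = (V (k + 1) - V k) / ((3 + μ - V k) * (3 + μ - V (k + 1))) := by
          simp only [hg]
          field_simp
          ring
        rw [this]
        apply div_le_div_of_nonneg_left (by linarith) (by positivity)
        rw [sq]
        exact mul_le_mul h2 h4 (by linarith) (by linarith)
      have hstep : g (k + 1) * energy V μ y (k + 1) = g k * energy V μ y k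
          + (g (k + 1) - g k) * (y k ^ 2 + y (k + 1) ^ 2 + y k * y (k + 1))
          + g (k + 1) * (f (k + 1) * (y (k + 2) - y k)) := by
        rw [energy_succ (hy k (by omega))]
        unfold energy
        linear_combination (y k * y (k + 1)) * hgk - (y k * y (k + 1)) * hgk1
      have hf : -(|f (k + 1)| * |y (k + 2) - y k|) ≤ g (k + 1) * (f (k + 1) * (y (k + 2) - y k)) := by
        rw [← abs_mul]
        have := neg_abs_le (f (k + 1) * (y (k + 2) - y k))
        nlinarith [abs_nonneg (f (k + 1) * (y (k + 2) - y k))]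
      have hq : (V (k + 1) - V k) * (y k ^ 2 + y (k + 1) ^ 2) / (2 * B ^ 2) ≤
          (g (k + 1) - g k) * (y k ^ 2 + y (k + 1) ^ 2 + y k * y (k + 1)) := by
        have h5 : (y k ^ 2 + y (k + 1) ^ 2) / 2 ≤ y k ^ 2 + y (k + 1) ^ 2 + y k * y (k + 1) := by
          nlinarith [sq_nonneg (y k + y (k + 1))]
        have h6 : 0 ≤ (V (k + 1) - V k) / B ^ 2 := div_nonneg (by linarith) (by positivity)
        calc _ = (V (k + 1) - V k) / B ^ 2 * ((y k ^ 2 + y (k + 1) ^ 2) / 2) := by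
              field_simp
          _ ≤ _ := mul_le_mul hdg h5 (by positivity) (h6.trans hdg)
      rw [sum_range_succ, sum_range_succ, add_div, hstep]
      linarith
  have h1 := key m le_rfl
  have hden' := hden m le_rfl
  have hgm : g m ≤ 1 := inv_le_one_of_one_le₀ hden'.1
  have hgm0 : 0 ≤ g m := inv_nonneg.2 (by linarith)
  have h2 : energy V μ y m ≤ 2 * (y m ^ 2 + y (m + 1) ^ 2) := energy_le hm1 (by linarith)
  have h3 : g m * energy V μ y m ≤ 2 * (y m ^ 2 + y (m + 1) ^ 2) := by
    have : 0 ≤ y m ^ 2 + y (m + 1) ^ 2 := by positivity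
    nlinarith
  rw [div_le_iff₀ (by positivity)] at h1
  nlinarith [mul_le_mul_of_nonneg_right h3 (by positivity : 0 ≤ 2 * B ^ 2)]

theorem sum_Ico_sq_add_sq (y : ℕ → ℝ) {m n : ℕ} (h : m ≤ n) :
    ∑ j ∈ Ico m n, (y j ^ 2 + y (j + 2) ^ 2) = 2 * ∑ j ∈ Ico m n, y (j + 1) ^ 2
      + y m ^ 2 - y n ^ 2 - y (m + 1) ^ 2 + y (n + 1) ^ 2 := by
  induction n, h using Nat.le_induction with
  | base => simp
  | succ n h ih =>
    rw [sum_Ico_succ_top h, sum_Ico_succ_top h, ih]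
    ring

/-- A virial estimate on the side of the recurrence where `V > μ + 1`. -/
theorem sum_sq_le_of_lt {V y f : ℕ → ℝ} {μ D : ℝ} {m n : ℕ} (hD : 1 ≤ D) (hmn : m ≤ n)
    (hV : ∀ j, m ≤ j → 1 ≤ D * (V (j + 1) - V j))
    (hm1 : μ + 3 / 2 ≤ V m) (hm2 : V m ≤ μ + 2) (hyn : y (n + 1) = 0)
    (hy : SolvesUpTo V μ y f n) :
    ∑ j ∈ Ico m n, y (j + 1) ^ 2 ≤ 600 * D * (y m ^ 2 + y (m + 1) ^ 2
        + ∑ j ∈ Ico m n, |f (j + 1)| / (V (j + 1) - μ - 1) * |y (j + 2) - y j|)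
      + 10 * ∑ j ∈ Ico m n, (f (j + 1) / (V (j + 1) - μ - 1)) ^ 2 := by
  have hmono : ∀ j, m ≤ j → V j ≤ V (j + 1) := by
    intro j hj
    have := hV j hj
    by_contra! h
    nlinarith
  have hden : ∀ j, m ≤ j → 1 / 2 ≤ V j - μ - 1 := by
    intro j hj
    induction j, hj using Nat.le_induction with
    | base => linarith
    | succ j hj ih => linarith [hmono j hj]
  set g : ℕ → ℝ := fun j => (V j - μ - 1)⁻¹ with hg
  have hg0 : ∀ j, m ≤ j → 0 < g j := fun j hj => inv_pos.2 (by linarith [hden j hj])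
  have hgV : ∀ j, m ≤ j → g j * (V j - μ - 1) = 1 := fun j hj =>
    inv_mul_cancel₀ (by linarith [hden j hj])
  have hdg : ∀ j, m ≤ j → g j - g (j + 1) = g j * g (j + 1) * (V (j + 1) - V j) := by
    intro j hj
    linear_combination g (j + 1) * hgV j hj - g j * hgV (j + 1) (by omega)
  have hdg0 : ∀ j, m ≤ j → 0 ≤ g j - g (j + 1) := by
    intro j hj
    rw [hdg j hj]
    have := hg0 j hj
    have := hg0 (j + 1) (by omega)
    have := hmono j hj
    have : 0 ≤ V (j + 1) - V j := by linarith
    positivity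
  have key : (∑ j ∈ Ico m n, (g j - g (j + 1)) * (y j ^ 2 + y (j + 1) ^ 2)) / 2
      + g n * energy V μ y n ≤ g m * energy V μ y m
        + ∑ j ∈ Ico m n, |f (j + 1)| / (V (j + 1) - μ - 1) * |y (j + 2) - y j| := by
    clear hyn
    induction n, hmn using Nat.le_induction with
    | base => simp
    | succ k hk ih =>
      have ih := ih fun j hj => hy j (by omega)
      have hstep : g (k + 1) * energy V μ y (k + 1) = g k * energy V μ y k
          - (g k - g (k + 1)) * (y k ^ 2 + y (k + 1) ^ 2 - y k * y (k + 1))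
          + g (k + 1) * (f (k + 1) * (y (k + 2) - y k)) := by
        rw [energy_succ (hy k (by omega))]
        unfold energy
        linear_combination (y k * y (k + 1)) * hgV (k + 1) (by omega)
          - (y k * y (k + 1)) * hgV k hk
      have hf : g (k + 1) * (f (k + 1) * (y (k + 2) - y k)) ≤
          |f (k + 1)| / (V (k + 1) - μ - 1) * |y (k + 2) - y k| := by
        have h1 : |f (k + 1)| / (V (k + 1) - μ - 1) * |y (k + 2) - y k|
            = g (k + 1) * |f (k + 1) * (y (k + 2) - y k)| := by
          rw [abs_mul, div_eq_mul_inv]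
          ring
        rw [h1]
        exact mul_le_mul_of_nonneg_left (le_abs_self _) (hg0 (k + 1) (by omega)).le
      have hq : (g k - g (k + 1)) * (y k ^ 2 + y (k + 1) ^ 2) / 2 ≤
          (g k - g (k + 1)) * (y k ^ 2 + y (k + 1) ^ 2 - y k * y (k + 1)) := by
        rw [mul_div_assoc]
        exact mul_le_mul_of_nonneg_left (by nlinarith [sq_nonneg (y k - y (k + 1))]) (hdg0 k hk)
      rw [sum_Ico_succ_top hk, sum_Ico_succ_top hk, add_div, hstep]
      linarith
  set S := ∑ j ∈ Ico m n, |f (j + 1)| / (V (j + 1) - μ - 1) * |y (j + 2) - y j|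
  set F := ∑ j ∈ Ico m n, (f (j + 1) / (V (j + 1) - μ - 1)) ^ 2 with hF
  set G := ∑ j ∈ Ico m n, (g j - g (j + 1)) * (y j ^ 2 + y (j + 1) ^ 2) with hG
  have hpt : ∀ j ∈ Ico m n, y (j + 1) ^ 2 ≤ 36 * D * ((g j - g (j + 1)) * (y j ^ 2 + y (j + 1) ^ 2))
      + 3 / 25 * (y j ^ 2 + y (j + 2) ^ 2) + 5 * (f (j + 1) / (V (j + 1) - μ - 1)) ^ 2 := by
    intro j hj
    obtain ⟨hj1, hj2⟩ := mem_Ico.1 hj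
    have hU := hden (j + 1) (by omega)
    have hU' := hden j hj1
    have hd := hdg0 j hj1
    rcases le_or_gt (V (j + 1) - μ - 1) 6 with h | h
    · have h1 : 1 ≤ 36 * D * (g j - g (j + 1)) := by
        have h2 : 1 / 6 ≤ g (j + 1) := by
          simp only [hg]
          rw [one_div]
          exact inv_anti₀ (by linarith) h
        have h3 : 1 / 6 ≤ g j := by
          simp only [hg]
          rw [one_div]
          exact inv_anti₀ (by linarith) (by linarith [hmono j hj1])
        have h4 : 1 / 36 ≤ g j * g (j + 1) := by nlinarith
        rw [hdg j hj1]
        nlinarith [hV j hj1]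
      have h2 := mul_le_mul_of_nonneg_right h1 (by positivity : 0 ≤ y j ^ 2 + y (j + 1) ^ 2)
      have h3 : 0 ≤ (f (j + 1) / (V (j + 1) - μ - 1)) ^ 2 := sq_nonneg _
      nlinarith [sq_nonneg (y j), sq_nonneg (y (j + 2))]
    · set U := V (j + 1) - μ - 1 with hUdef
      have hfU : f (j + 1) = (f (j + 1) / U) * U := by field_simp
      have heq := hy j hj2
      set φ := f (j + 1) / U
      have h1 : (U - 1) * y (j + 1) = φ * U - (y j + y (j + 2)) := by
        rw [← hfU]
        have : 2 + μ - V (j + 1) = 1 - U := by simp only [hUdef]; ring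
        rw [this] at heq
        linarith
      have h2 : (U - 1) ^ 2 * y (j + 1) ^ 2 ≤ 3 * (φ ^ 2 * U ^ 2 + y j ^ 2 + y (j + 2) ^ 2) := by
        rw [← mul_pow, h1]
        nlinarith [sq_nonneg (φ * U + y j), sq_nonneg (φ * U + y (j + 2)),
          sq_nonneg (y j - y (j + 2))]
      have h3 : 25 ≤ (U - 1) ^ 2 := by nlinarith
      have h4 : U ^ 2 ≤ 36 / 25 * (U - 1) ^ 2 := by nlinarith
      have h5 : 0 ≤ 36 * D * ((g j - g (j + 1)) * (y j ^ 2 + y (j + 1) ^ 2)) := by positivity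
      have h6 : (U - 1) ^ 2 * y (j + 1) ^ 2 ≤
          (U - 1) ^ 2 * (3 / 25 * (y j ^ 2 + y (j + 2) ^ 2) + 5 * φ ^ 2) := by
        have h7 : y j ^ 2 + y (j + 2) ^ 2 ≤ (U - 1) ^ 2 / 25 * (y j ^ 2 + y (j + 2) ^ 2) :=
          le_mul_of_one_le_left (by positivity) (by linarith)
        have h8 := mul_le_mul_of_nonneg_left h4 (sq_nonneg φ)
        have h9 := mul_nonneg (sq_nonneg φ) (sq_nonneg (U - 1))
        linarith
      have h7 := le_of_mul_le_mul_left h6 (by linarith)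
      linarith
  have hsum := sum_le_sum hpt
  rw [sum_add_distrib, sum_add_distrib, ← mul_sum, ← mul_sum, ← mul_sum, ← hG, ← hF,
    sum_Ico_sq_add_sq y hmn, hyn] at hsum
  have hQn : 0 ≤ g n * energy V μ y n := by
    refine mul_nonneg (hg0 n hmn).le ?_
    simp only [energy, hyn]
    nlinarith [sq_nonneg (y n)]
  have hQm : g m * energy V μ y m ≤ 4 * (y m ^ 2 + y (m + 1) ^ 2) := by
    have h1 : energy V μ y m ≤ 2 * (y m ^ 2 + y (m + 1) ^ 2) :=
      energy_le (by linarith) (by linarith)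
    have h2 : g m ≤ 2 := by
      simp only [hg]
      rw [inv_le_comm₀ (by linarith) (by norm_num)]
      linarith
    have h3 := (hg0 m le_rfl).le
    have : 0 ≤ y m ^ 2 + y (m + 1) ^ 2 := by positivity
    nlinarith
  have hS : 0 ≤ S := sum_nonneg fun j hj =>
    mul_nonneg (div_nonneg (abs_nonneg _) (by linarith [hden (j + 1) (by simp at hj; omega)]))
      (abs_nonneg _)
  have hF0 : 0 ≤ F := sum_nonneg fun j _ => sq_nonneg _
  have hGle : G ≤ 8 * (y m ^ 2 + y (m + 1) ^ 2) + 2 * S := by linarith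
  have hDG := mul_le_mul_of_nonneg_left hGle (by linarith : 0 ≤ D)
  have hDA : y m ^ 2 + y (m + 1) ^ 2 ≤ D * (y m ^ 2 + y (m + 1) ^ 2) :=
    le_mul_of_one_le_left (by positivity) hD
  have hDS : 0 ≤ D * S := by positivity
  have h1 := sq_nonneg (y m)
  have h2 := sq_nonneg (y (m + 1))
  have h3 := sq_nonneg (y n)
  linarith

/-- `V` starts at `0`, its mean slope `V j / j` increases, and its steps are at most `K` times that
mean slope. -/
structure IsProfile (V : ℕ → ℝ) (K : ℝ) : Prop where
  zero : V 0 = 0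
  pos : ∀ j, 1 ≤ j → 0 < V j
  slope_le : ∀ i j : ℕ, i ≤ j → j * V i ≤ i * V j
  step_le : ∀ j : ℕ, 1 ≤ j → j * (V (j + 1) - V j) ≤ K * V j
  le_of_le_two_mul : ∀ i j : ℕ, j ≤ 2 * i → V j ≤ K * V i

namespace IsProfile

variable {V : ℕ → ℝ} {K : ℝ}

theorem nonneg (hV : IsProfile V K) (j : ℕ) : 0 ≤ V j := by
  rcases Nat.eq_zero_or_pos j with rfl | h
  · exact hV.zero.ge
  · exact (hV.pos j h).le

theorem le_step (hV : IsProfile V K) (j : ℕ) : V j ≤ j * (V (j + 1) - V j) := by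
  have := hV.slope_le j (j + 1) (Nat.le_succ j)
  push_cast at this
  linarith

theorem monotone (hV : IsProfile V K) : Monotone V := by
  refine monotone_nat_of_le_succ fun j => ?_
  rcases Nat.eq_zero_or_pos j with rfl | h
  · rw [hV.zero]
    exact hV.nonneg _
  · have h1 := hV.le_step j
    have h2 := hV.pos j h
    have h3 : (0 : ℝ) < j := by exact_mod_cast h
    by_contra! h4
    nlinarith

/-- If `b ^ (-3)` is the mean slope at `J`, then the earlier steps are at most `K b ^ (-3)`. -/
theorem step_le_of_lt (hV : IsProfile V K) (hK : 0 ≤ K) {J j : ℕ} {b : ℝ} (hb : b ^ 3 * V J = J)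
    (hj : 1 ≤ j) (hjJ : j ≤ J) : b ^ 3 * (V (j + 1) - V j) ≤ K := by
  have h1 := hV.step_le j hj
  have h2 := hV.slope_le j J hjJ
  have hj0 : (0 : ℝ) < j := by exact_mod_cast hj
  have hVJ := hV.pos J (by omega)
  have hJ0 : (0 : ℝ) < J := by exact_mod_cast (by omega : 0 < J)
  have hb0 : 0 < b ^ 3 := by
    by_contra! h
    nlinarith
  have h3 : b ^ 3 * V j ≤ j := by
    refine le_of_mul_le_mul_right ?_ hVJ
    calc b ^ 3 * V j * V J = J * V j := by rw [← hb]; ring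
      _ ≤ _ := h2
  refine le_of_mul_le_mul_left ?_ hj0
  calc j * (b ^ 3 * (V (j + 1) - V j)) = b ^ 3 * (j * (V (j + 1) - V j)) := by ring
    _ ≤ b ^ 3 * (K * V j) := mul_le_mul_of_nonneg_left h1 hb0.le
    _ = K * (b ^ 3 * V j) := by ring
    _ ≤ K * j := mul_le_mul_of_nonneg_left h3 hK
    _ = j * K := by ring

theorem le_apply_sub (hV : IsProfile V K) (hK : 0 ≤ K) {J : ℕ} {b : ℝ}
    (hb : b ^ 3 * V J = J) {t : ℕ} (ht : t < J) : b ^ 3 * (V J - V (J - t)) ≤ t * K := by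
  induction t with
  | zero => simp
  | succ t ih =>
    have ih := ih (by omega)
    have h1 := hV.step_le_of_lt hK hb (by omega : 1 ≤ J - (t + 1)) (by omega)
    have e1 : J - (t + 1) + 1 = J - t := by omega
    rw [e1] at h1
    push_cast
    linarith

end IsProfile

/-- The stopping index in the initial stretch on which a solution `x` grows: it stops growing at
`J`, or `V - μ` reaches there the size at which the solution starts to oscillate. -/
structure IsTurn (V : ℕ → ℝ) (μ : ℝ) (x : ℕ → ℝ) (J : ℕ) : Prop where
  two_le : 2 ≤ J
  zero : x 0 = 0
  lt_succ : ∀ j < J, x j < x (j + 1)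
  before : ∀ j, 1 ≤ j → j < J → V j ≤ μ ∨ (V j - μ) ^ 3 < (V j / j) ^ 2
  halt : x (J + 1) ≤ x J ∨ μ < V J ∧ (V J / J) ^ 2 ≤ (V J - μ) ^ 3

/-- A solution that starts positive and vanishes at `n + 1` has a stopping index, and it lies beyond
all `k` with `V k < μ`. -/
theorem exists_isTurn {V x : ℕ → ℝ} {μ : ℝ} {n k : ℕ} (hV : Monotone V) (hx0 : x 0 = 0)
    (hx1 : 0 < x 1) (hxn : x (n + 1) = 0) (hx : SolvesUpTo V μ x 0 n) (hk1 : 1 ≤ k)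
    (hkn : k ≤ n) (hk : V k < μ) : ∃ J, IsTurn V μ x J ∧ k < J ∧ J ≤ n := by
  classical
  let p : ℕ → Prop := fun j => 1 ≤ j ∧
    (x (j + 1) ≤ x j ∨ μ < V j ∧ (V j / j) ^ 2 ≤ (V j - μ) ^ 3)
  have hgrow : ∀ j ≤ n, (∀ i, 1 ≤ i → i ≤ j → x i < x (i + 1)) → 0 < x (j + 1) := by
    intro j
    induction j with
    | zero => exact fun _ _ => hx1
    | succ j ih =>
      intro hj h
      exact (ih (by omega) fun i h1 h2 => h i h1 (by omega)).trans (h (j + 1) (by omega) le_rfl)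
  have hex : ∃ j, j ≤ n ∧ p j := by
    by_contra! hcon
    have : 0 < x (n + 1) := hgrow n le_rfl fun i h1 h2 => by
      by_contra! h3
      exact hcon i h2 ⟨h1, Or.inl h3⟩
    linarith
  obtain ⟨j0, hj0n, hj0⟩ := hex
  have hexp : ∃ j, p j := ⟨j0, hj0⟩
  set J := Nat.find hexp with hJ
  have hJp : p J := Nat.find_spec hexp
  have hJn : J ≤ n := (Nat.find_min' hexp hj0).trans hj0n
  have hmin : ∀ j, 1 ≤ j → j < J → x j < x (j + 1) ∧
      (V j ≤ μ ∨ (V j - μ) ^ 3 < (V j / j) ^ 2) := by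
    intro j h1 h2
    have := Nat.find_min hexp h2
    simp only [p] at this
    push Not at this
    obtain ⟨h3, h4⟩ := this h1
    refine ⟨h3, ?_⟩
    by_cases h5 : V j ≤ μ
    · exact Or.inl h5
    · exact Or.inr (h4 (by linarith))
  have hinc : ∀ j ≤ k, 0 < x (j + 1) ∧ x j < x (j + 1) := by
    intro j
    induction j with
    | zero => exact fun _ => ⟨hx1, by rw [hx0]; exact hx1⟩
    | succ j ih =>
      intro hj
      obtain ⟨h1, h2⟩ := ih (by omega)
      have h3 := hx j (by omega)
      have h4 : V (j + 1) < μ := (hV hj).trans_lt hk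
      simp only [Pi.zero_apply, add_zero] at h3
      have h5 : x (j + 1) < x (j + 2) := by nlinarith
      exact ⟨h1.trans h5, h5⟩
  have hkJ : k < J := by
    by_contra! h
    rcases hJp.2 with h1 | h1
    · linarith [(hinc J h).2]
    · linarith [hV h, h1.1]
  refine ⟨J, ⟨by omega, hx0, ?_, fun j h1 h2 => (hmin j h1 h2).2, hJp.2⟩, hkJ, hJn⟩
  intro j hj
  rcases Nat.eq_zero_or_pos j with rfl | h
  · rw [hx0]
    exact hx1
  · exact (hmin j h hj).1

namespace IsTurn

variable {V x : ℕ → ℝ} {μ K b : ℝ} {J : ℕ}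

theorem mono (h : IsTurn V μ x J) {i j : ℕ} (hij : i ≤ j) (hj : j ≤ J) : x i ≤ x j := by
  induction j, hij using Nat.le_induction with
  | base => exact le_rfl
  | succ j hij ih => exact (ih (by omega)).trans (h.lt_succ j (by omega)).le

theorem nonneg (h : IsTurn V μ x J) {j : ℕ} (hj : j ≤ J) : 0 ≤ x j := by
  have := h.mono (Nat.zero_le j) hj
  rwa [h.zero] at this

theorem pos (h : IsTurn V μ x J) {j : ℕ} (hj1 : 1 ≤ j) (hj : j ≤ J) : 0 < x j := by
  have h1 := h.lt_succ 0 (by have := h.two_le; omega)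
  rw [h.zero] at h1
  exact h1.trans_le (h.mono hj1 hj)

theorem lt_apply (h : IsTurn V μ x J) (hx : SolvesUpTo V μ x 0 J) : μ < V J := by
  have h2 := h.two_le
  rcases h.halt with h1 | h1
  · obtain ⟨i, rfl⟩ : ∃ i, J = i + 1 := ⟨J - 1, by omega⟩
    have h3 := hx i (by omega)
    have h4 := h.lt_succ i (by omega)
    have h5 := h.pos (j := i + 1) (by omega) le_rfl
    simp only [Pi.zero_apply, add_zero] at h3
    simp only [add_assoc, one_add_one_eq_two] at h1
    by_contra! h6
    nlinarith
  · exact h1.1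

theorem diff_sub_le (h : IsTurn V μ x J) (hV : Monotone V) (hx : SolvesUpTo V μ x 0 J) {t : ℕ}
    (ht : t ≤ J) :
    x (J - t + 1) - x (J - t) ≤ x (J + 1) - x J + t * ((V J - μ) * x J) := by
  induction t with
  | zero => simp
  | succ t ih =>
    have ih := ih (by omega)
    obtain ⟨i, hi⟩ : ∃ i, J = i + t + 1 := ⟨J - t - 1, by omega⟩
    have e1 : J - (t + 1) = i := by omega
    have e2 : J - t = i + 1 := by omega
    rw [e1]
    rw [e2] at ih
    have h1 := hx i (by omega)
    simp only [Pi.zero_apply, add_zero] at h1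
    have h2 : (V (i + 1) - μ) * x (i + 1) ≤ (V J - μ) * x J := by
      have h3 := hV (by omega : i + 1 ≤ J)
      have h4 := h.mono (by omega : i + 1 ≤ J) le_rfl
      have h5 := h.nonneg (by omega : i + 1 ≤ J)
      have h6 := h.lt_apply hx
      calc _ ≤ (V J - μ) * x (i + 1) := mul_le_mul_of_nonneg_right (by linarith) h5
        _ ≤ _ := mul_le_mul_of_nonneg_left h4 (by linarith)
    push_cast
    linarith

theorem sub_le (h : IsTurn V μ x J) (hV : Monotone V) (hx : SolvesUpTo V μ x 0 J) {t : ℕ}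
    (ht : t ≤ J) {E : ℝ} (hE : x (J + 1) - x J ≤ E) :
    x J - x (J - t) ≤ t * (E + t * ((V J - μ) * x J)) := by
  have hpos : 0 ≤ (V J - μ) * x J :=
    mul_nonneg (by linarith [h.lt_apply hx]) (h.nonneg le_rfl)
  induction t with
  | zero => simp
  | succ t ih =>
    have ih := ih (by omega)
    have h1 := h.diff_sub_le hV hx ht
    have e1 : J - (t + 1) + 1 = J - t := by omega
    rw [e1] at h1
    push_cast at *
    have : 0 ≤ (t : ℝ) * ((V J - μ) * x J) := by positivity
    nlinarith

theorem pos_scale (h : IsTurn V μ x J) (hV : IsProfile V K) (hb : b ^ 3 * V J = J) : 0 < b := by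
  have h1 := h.two_le
  have h2 := hV.pos J (by omega)
  have h3 : (0 : ℝ) < J := by exact_mod_cast (by omega : 0 < J)
  by_contra! h4
  have : b ^ 3 ≤ 0 := by
    have := sq_nonneg b
    nlinarith
  nlinarith

theorem slope_eq (h : IsTurn V μ x J) (hV : IsProfile V K) (hb : b ^ 3 * V J = J) :
    (V J / J) ^ 2 = (1 / b ^ 2) ^ 3 := by
  have h1 := h.two_le
  have h2 := hV.pos J (by omega)
  have h3 := h.pos_scale hV hb
  rw [← hb]
  field_simp

theorem scale_le (h : IsTurn V μ x J) (hV : IsProfile V K) (hx : SolvesUpTo V μ x 0 J)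
    (hμ : 0 ≤ μ) (hb : b ^ 3 * V J = J) : b ≤ J := by
  have h1 := h.two_le
  have hVJ := hV.pos J (by omega)
  have hJ : (0 : ℝ) < J := by exact_mod_cast (by omega : 0 < J)
  have h3 := h.pos_scale hV hb
  have key : 1 ≤ (J : ℝ) ^ 2 * V J := by
    rcases h.halt with h4 | ⟨h4, h5⟩
    · have h5 := h.sub_le hV.monotone hx le_rfl (by linarith : x (J + 1) - x J ≤ 0)
      rw [Nat.sub_self, h.zero] at h5
      have h6 := h.pos (by omega) le_rfl
      refine le_of_mul_le_mul_right ?_ h6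
      have : 0 ≤ (J : ℝ) ^ 2 * μ * x J := by positivity
      nlinarith
    · have h6 : (V J - μ) ^ 3 ≤ V J ^ 3 := pow_le_pow_left₀ (by linarith) (by linarith) 3
      rw [div_pow] at h5
      have h7 := h5.trans h6
      rw [div_le_iff₀ (by positivity)] at h7
      refine le_of_mul_le_mul_left ?_ (by positivity : 0 < V J ^ 2)
      linarith
  by_contra! h4
  have h5 : (J : ℝ) ^ 3 < b ^ 3 := pow_lt_pow_left₀ h4 hJ.le (by norm_num)
  have h6 : (J : ℝ) ^ 3 * V J < b ^ 3 * V J := mul_lt_mul_of_pos_right h5 hVJ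
  rw [hb] at h6
  have h7 := mul_le_mul_of_nonneg_left key hJ.le
  nlinarith

theorem excess_le (h : IsTurn V μ x J) (hV : IsProfile V K) (hK : 0 ≤ K)
    (hb : b ^ 3 * V J = J) (hb1 : 1 ≤ b) : b ^ 2 * (V J - μ) ≤ 1 + K := by
  have h1 := h.two_le
  obtain ⟨i, rfl⟩ : ∃ i, J = i + 1 := ⟨J - 1, by omega⟩
  have h2 := hV.step_le_of_lt hK hb (by omega : 1 ≤ i) (by omega)
  have h3 : b ^ 2 * (V i - μ) ≤ 1 := by
    rcases h.before i (by omega) (by omega) with h4 | h4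
    · have : 0 ≤ b ^ 2 := by positivity
      nlinarith
    · have h5 : V i / i ≤ V (i + 1) / (i + 1 : ℕ) := by
        have hi : (0 : ℝ) < i := by exact_mod_cast (by omega : 0 < i)
        rw [div_le_div_iff₀ hi (by positivity)]
        linarith [hV.slope_le i (i + 1) (by omega)]
      have h6 : (V i / i) ^ 2 ≤ (V (i + 1) / (i + 1 : ℕ)) ^ 2 :=
        pow_le_pow_left₀ (div_nonneg (hV.nonneg i) (by positivity)) h5 2
      rw [h.slope_eq hV hb] at h6
      have h7 : V i - μ < 1 / b ^ 2 := by
        by_contra! h8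
        have := pow_le_pow_left₀ (by positivity) h8 3
        linarith
      rw [lt_div_iff₀ (by positivity)] at h7
      linarith
  have h4 : 0 ≤ V (i + 1) - V i := by linarith [hV.monotone (Nat.le_succ i)]
  have h5 : b ^ 2 * (V (i + 1) - V i) ≤ b ^ 3 * (V (i + 1) - V i) :=
    mul_le_mul_of_nonneg_right (pow_le_pow_right₀ hb1 (by norm_num)) h4
  linarith

/-- At the stopping index the solution grows by at most a factor `1 + O(1 / b)`. -/
theorem diff_le (h : IsTurn V μ x J) (hV : IsProfile V K) (hx : SolvesUpTo V μ x 0 J)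
    (hμ : 0 ≤ μ) (hK : 2 ≤ K) (hb : b ^ 3 * V J = J) (hbK : K ≤ b) :
    b * (x (J + 1) - x J) ≤ 2 * K * x J := by
  have h1 := h.two_le
  have hxJ := h.nonneg (le_refl J)
  rcases h.halt with h2 | ⟨h2, h3⟩
  · have : 0 ≤ 2 * K * x J := by positivity
    nlinarith
  by_cases hD : x (J + 1) - x J ≤ 0
  · have : 0 ≤ 2 * K * x J := by positivity
    nlinarith
  have hb0 : 0 < b := by linarith
  have hbJ := h.scale_le hV hx hμ hb
  set p := ⌊b / K⌋₊ with hp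
  have hpb : (p : ℝ) ≤ b / K := Nat.floor_le (by positivity)
  have hz : 1 ≤ b / K := (one_le_div (by linarith)).2 hbK
  have hp1 : 1 ≤ p := (Nat.one_le_floor_iff _).2 hz
  have hp2 : b / K ≤ 2 * p := by
    have h4 := Nat.lt_floor_add_one (b / K)
    have h5 : (1 : ℝ) ≤ p := by exact_mod_cast hp1
    rw [← hp] at h4
    linarith
  have hpK : (p : ℝ) * K ≤ b := (le_div_iff₀ (by linarith)).1 hpb
  have hpJ : p < J := by
    have : (p : ℝ) < J := by
      have : (1 : ℝ) ≤ p := by exact_mod_cast hp1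
      nlinarith
    exact_mod_cast this
  have hex : 1 ≤ b ^ 2 * (V J - μ) := by
    rw [h.slope_eq hV hb] at h3
    have h4 : 1 / b ^ 2 ≤ V J - μ := le_of_pow_le_pow_left₀ (by norm_num) (by linarith) h3
    rw [div_le_iff₀ (by positivity)] at h4
    linarith
  have hVp : ∀ t ≤ p, μ ≤ V (J - t) := by
    intro t ht
    have h4 := hV.le_apply_sub (by linarith) hb (by omega : t < J)
    have h5 : (t : ℝ) * K ≤ b := by
      have : (t : ℝ) ≤ p := by exact_mod_cast ht
      nlinarith
    have h6 : b ^ 2 * (V J - V (J - t)) ≤ 1 := by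
      refine le_of_mul_le_mul_left ?_ hb0
      linarith
    by_contra! h7
    have : 0 < b ^ 2 * (μ - V (J - t)) := by
      have : 0 < μ - V (J - t) := by linarith
      positivity
    linarith
  have hDt : ∀ t ≤ p, x (J + 1) - x J ≤ x (J - t + 1) - x (J - t) := by
    intro t
    induction t with
    | zero => simp
    | succ t ih =>
      intro ht
      have ih := ih (by omega)
      obtain ⟨i, hi⟩ : ∃ i, J = i + t + 1 := ⟨J - t - 1, by omega⟩
      have e1 : J - (t + 1) = i := by omega
      have e2 : J - t = i + 1 := by omega
      have h4 := hVp t (by omega)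
      rw [e2] at ih h4
      rw [e1]
      have h5 := hx i (by omega)
      have h6 := h.nonneg (by omega : i + 1 ≤ J)
      simp only [Pi.zero_apply, add_zero] at h5
      nlinarith [mul_nonneg (sub_nonneg.2 h4) h6]
  have hsum : ∀ t ≤ p, t * (x (J + 1) - x J) ≤ x J - x (J - t) := by
    intro t
    induction t with
    | zero => simp
    | succ t ih =>
      intro ht
      have ih := ih (by omega)
      have h4 := hDt (t + 1) ht
      have e1 : J - (t + 1) + 1 = J - t := by omega
      rw [e1] at h4
      push_cast
      linarith
  have h4 := hsum p le_rfl
  have h5 := h.nonneg (by omega : J - p ≤ J)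
  have h6 : b ≤ 2 * K * p := by
    rw [div_le_iff₀ (by linarith)] at hp2
    linarith
  calc _ ≤ 2 * K * p * (x (J + 1) - x J) := mul_le_mul_of_nonneg_right h6 (by linarith)
    _ = 2 * K * (p * (x (J + 1) - x J)) := by ring
    _ ≤ 2 * K * x J := mul_le_mul_of_nonneg_left (by linarith) (by linarith)

/-- The solution is comparable with `x J` on a window of length proportional to `b`. -/
theorem half_le (h : IsTurn V μ x J) (hV : IsProfile V K) (hx : SolvesUpTo V μ x 0 J)
    (hμ : 0 ≤ μ) (hK : 2 ≤ K) (hb : b ^ 3 * V J = J) (hbK : K ≤ b) {t : ℕ}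
    (ht : 8 * K * t ≤ b) : x J ≤ 2 * x (J - t) := by
  have hb0 : 0 < b := by linarith
  have hbJ := h.scale_le hV hx hμ hb
  have htJ : t ≤ J := by
    have : (t : ℝ) ≤ J := by
      have : (0 : ℝ) ≤ t := by positivity
      nlinarith
    exact_mod_cast this
  have hxJ := h.nonneg (le_refl J)
  have h1 := h.diff_le hV hx hμ hK hb hbK
  have h2 := h.excess_le hV (by linarith) hb (by linarith)
  have h3 := h.sub_le hV.monotone hx htJ (E := 2 * K * x J / b)
    (by rw [le_div_iff₀ hb0]; linarith)
  have ht0 : (0 : ℝ) ≤ t := by positivity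
  have h4 : (t : ℝ) * (2 * K * x J / b) ≤ x J / 4 := by
    rw [mul_div_assoc', div_le_iff₀ hb0]
    nlinarith
  have h5 : (t : ℝ) * (t * ((V J - μ) * x J)) ≤ x J / 4 := by
    have h6 : (8 * K * t) ^ 2 ≤ b ^ 2 := pow_le_pow_left₀ (by positivity) ht 2
    have h7 := (h.lt_apply hx).le
    have h8 : (8 * K * t) ^ 2 * (V J - μ) ≤ 1 + K :=
      (mul_le_mul_of_nonneg_right h6 (by linarith)).trans h2
    have h9 : (t : ℝ) ^ 2 * (V J - μ) ≤ 1 / 4 := by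
      have h10 : 16 * K ^ 2 * ((t : ℝ) ^ 2 * (V J - μ)) ≤ 16 * K ^ 2 * (1 / 4) := by nlinarith
      exact le_of_mul_le_mul_left h10 (by positivity)
    nlinarith [mul_le_mul_of_nonneg_right h9 hxJ]
  linarith

theorem energy_le (h : IsTurn V μ x J) (hV : IsProfile V K) (hx : SolvesUpTo V μ x 0 J)
    (hμ : 0 ≤ μ) (hK : 2 ≤ K) (hb : b ^ 3 * V J = J) (hbK : K ≤ b) :
    energy V μ x J ≤ 7 * K ^ 2 * ((V J - μ) * x J ^ 2) := by
  have h1 := h.two_le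
  have hb0 : 0 < b := by linarith
  have hxJ := h.nonneg (le_refl J)
  have hδ := h.lt_apply hx
  have hex := h.excess_le hV (by linarith) hb (by linarith)
  obtain ⟨δ, hδdef⟩ : ∃ δ, δ = V J - μ := ⟨_, rfl⟩
  rw [← hδdef] at hex ⊢
  have hδ0 : 0 < δ := by linarith
  have hQ : energy V μ x J = (x (J + 1) - x J) ^ 2 + δ * (x J * x (J + 1)) := by
    simp only [energy, hδdef]
    ring
  have hX : 0 ≤ δ * x J ^ 2 := by positivity
  have hKX : 1 * (δ * x J ^ 2) ≤ K ^ 2 * (δ * x J ^ 2) :=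
    mul_le_mul_of_nonneg_right (by nlinarith) hX
  have hδ2 : δ ≤ 2 := by
    have h3 : b ^ 2 * δ ≤ b ^ 2 * 2 := by nlinarith
    exact le_of_mul_le_mul_left h3 (by positivity)
  rw [hQ]
  by_cases hD : x (J + 1) ≤ x J
  · obtain ⟨i, rfl⟩ : ∃ i, J = i + 1 := ⟨J - 1, by omega⟩
    have h3 := hx i (by omega)
    have h4 := h.lt_succ i (by omega)
    simp only [Pi.zero_apply, add_zero] at h3
    simp only [add_assoc, one_add_one_eq_two] at hD ⊢
    have h5 : x (i + 1) - x (i + 2) ≤ δ * x (i + 1) := by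
      rw [hδdef]
      linear_combination h4.le - h3
    have h6 : (x (i + 2) - x (i + 1)) ^ 2 ≤ 2 * (δ * x (i + 1) ^ 2) := by
      have : (x (i + 1) - x (i + 2)) ^ 2 ≤ (δ * x (i + 1)) ^ 2 :=
        pow_le_pow_left₀ (by linarith) h5 2
      nlinarith
    have h7 : δ * (x (i + 1) * x (i + 2)) ≤ δ * x (i + 1) ^ 2 := by
      rw [sq]
      exact mul_le_mul_of_nonneg_left (mul_le_mul_of_nonneg_left hD hxJ) hδ0.le
    linarith
  · push Not at hD
    have h2 : μ < V J ∧ (V J / J) ^ 2 ≤ (V J - μ) ^ 3 := by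
      rcases h.halt with h2 | h2
      · linarith
      · exact h2
    have hex' : 1 ≤ b ^ 2 * δ := by
      have h3 := h2.2
      rw [h.slope_eq hV hb] at h3
      have h4 : 1 / b ^ 2 ≤ V J - μ := le_of_pow_le_pow_left₀ (by norm_num) (by linarith) h3
      rw [div_le_iff₀ (by positivity), ← hδdef] at h4
      linarith
    have h3 := h.diff_le hV hx hμ hK hb hbK
    have h4 : (x (J + 1) - x J) ^ 2 ≤ 4 * K ^ 2 * (δ * x J ^ 2) := by
      have h5 : (b * (x (J + 1) - x J)) ^ 2 ≤ (2 * K * x J) ^ 2 :=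
        pow_le_pow_left₀ (mul_nonneg hb0.le (by linarith)) h3 2
      refine le_of_mul_le_mul_left ?_ (by positivity : 0 < b ^ 2)
      have h6 : 0 ≤ 4 * K ^ 2 * x J ^ 2 := by positivity
      nlinarith [mul_le_mul_of_nonneg_left hex' h6]
    have h5 : x (J + 1) ≤ 3 * x J := by
      have : b * (x (J + 1) - x J) ≤ b * (2 * x J) := by nlinarith
      linarith [le_of_mul_le_mul_left this hb0]
    have h6 : δ * (x J * x (J + 1)) ≤ 3 * (δ * x J ^ 2) := by
      have := mul_le_mul_of_nonneg_left (mul_le_mul_of_nonneg_left h5 hxJ) hδ0.le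
      nlinarith
    linarith

/-- The amplitude of the solution in the range where it oscillates is at most of the order of
`x J`. -/
theorem amplitude_le (h : IsTurn V μ x J) (hV : IsProfile V K) {m : ℕ} (hJm : J ≤ m)
    (hx : SolvesUpTo V μ x 0 m) (hμ : 0 ≤ μ) (hK : 2 ≤ K) (hb : b ^ 3 * V J = J) (hbK : K ≤ b)
    (hm : V m ≤ μ + 2) : x m ^ 2 + x (m + 1) ^ 2 ≤ 14 * K ^ 2 * x J ^ 2 := by
  have hxJ : SolvesUpTo V μ x 0 J := fun j hj => hx j (by omega)
  have h1 := h.lt_apply hxJ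
  have h2 := energy_mul_le hV.monotone h1 hJm hx
  have h3 := h.energy_le hV hxJ hμ hK hb hbK
  have h4 := hV.monotone hJm
  have h5 : 0 < V m - μ := by linarith
  have h6 : (x m ^ 2 + x (m + 1) ^ 2) * (V m - μ) / 2 ≤ energy V μ x m := by
    unfold energy
    nlinarith [mul_nonneg (sub_nonneg.2 hm) (sq_nonneg (x m - x (m + 1)))]
  have h7 := mul_le_mul_of_nonneg_right h3 h5.le
  have h8 := mul_le_mul_of_nonneg_right h6 (by linarith : 0 ≤ V J - μ)
  refine le_of_mul_le_mul_right ?_ (mul_pos h5 (by linarith : 0 < V J - μ))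
  linarith

end IsTurn

theorem sum_range_inv_sqrt_le (n : ℕ) :
    ∑ j ∈ range n, 1 / √((n - j : ℕ) : ℝ) ≤ 2 * √n := by
  rw [← Finset.sum_range_reflect]
  have h1 : ∀ j ∈ range n, 1 / √((n - (n - 1 - j) : ℕ) : ℝ) ≤ 2 * (√((j + 1 : ℕ) : ℝ) - √(j : ℝ)) := by
    intro j hj
    have hj := mem_range.1 hj
    have e : n - (n - 1 - j) = j + 1 := by omega
    rw [e]
    have h2 : 0 < √((j + 1 : ℕ) : ℝ) := Real.sqrt_pos.2 (by positivity)
    have h3 : √(j : ℝ) ≤ √((j + 1 : ℕ) : ℝ) := Real.sqrt_le_sqrt (by push_cast; linarith)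
    have h4 := Real.sq_sqrt (by positivity : (0 : ℝ) ≤ ((j + 1 : ℕ) : ℝ))
    have h5 := Real.sq_sqrt (by positivity : (0 : ℝ) ≤ (j : ℝ))
    rw [div_le_iff₀ h2]
    push_cast at *
    nlinarith [Real.sqrt_nonneg (j : ℝ)]
  refine (sum_le_sum h1).trans ?_
  rw [← mul_sum, Finset.sum_range_sub (fun j => √((j : ℕ) : ℝ))]
  simp

namespace IsTurn

variable {V x : ℕ → ℝ} {μ K b : ℝ} {J : ℕ}

/-- Growth of the solution where `V ≤ μ`. -/
theorem growth (h : IsTurn V μ x J) (hV : Monotone V) (hx : SolvesUpTo V μ x 0 J) {j : ℕ}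
    (hj : j < J) (hVj : V j ≤ μ) : (1 + √(μ - V j)) * x j ≤ x (j + 1) ∧
      √(μ - V j) * ∑ i ∈ range (j + 1), x i ^ 2 ≤ x j * x (j + 1) := by
  induction j with
  | zero => simp [h.zero, h.nonneg (j := 1) (by have := h.two_le; omega)]
  | succ j ih =>
    have hVV := hV (Nat.le_succ j)
    simp only [Nat.succ_eq_add_one] at hVV
    obtain ⟨h1, h2⟩ := ih (by omega) (by linarith)
    have h3 := hx j (by omega)
    simp only [Pi.zero_apply, add_zero] at h3
    have hσ : √(μ - V (j + 1)) ≤ √(μ - V j) := Real.sqrt_le_sqrt (by linarith)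
    have hσ2 := Real.sq_sqrt (by linarith : 0 ≤ μ - V (j + 1))
    have hσ0 := Real.sqrt_nonneg (μ - V (j + 1))
    set σ := √(μ - V (j + 1))
    set σ' := √(μ - V j)
    have hxj := h.nonneg (by omega : j ≤ J)
    have hxj1 := h.nonneg (by omega : j + 1 ≤ J)
    have hxj2 := h.mono (Nat.le_succ j) (by omega)
    simp only [Nat.succ_eq_add_one] at hxj2
    have h4 : (1 + σ) * x j ≤ x (j + 1) := by nlinarith
    have h5 : (1 + σ) * x (j + 1) ≤ x (j + 2) := by
      have h6 : x (j + 2) = (2 + σ ^ 2) * x (j + 1) - x j := by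
        rw [hσ2]
        linarith
      refine le_of_mul_le_mul_left ?_ (by linarith : 0 < 1 + σ)
      rw [h6]
      nlinarith [mul_nonneg (pow_nonneg hσ0 3) hxj1]
    refine ⟨h5, ?_⟩
    rw [sum_range_succ]
    have hP : 0 ≤ ∑ i ∈ range (j + 1), x i ^ 2 := sum_nonneg fun i _ => sq_nonneg _
    have h7 : σ * ∑ i ∈ range (j + 1), x i ^ 2 ≤ x j * x (j + 1) :=
      (mul_le_mul_of_nonneg_right hσ hP).trans h2
    have h8 := mul_le_mul_of_nonneg_left h5 hxj1
    nlinarith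

theorem sum_sq_le_add (h : IsTurn V μ x J) {j t : ℕ} (hj : j + t < J) {s : ℝ} (hs : 0 ≤ s)
    (hP : ∑ i ∈ range (j + 1), x i ^ 2 ≤ s * (x j * x (j + 1))) :
    ∑ i ∈ range (j + t + 1), x i ^ 2 ≤ (s + t) * (x (j + t) * x (j + t + 1)) := by
  induction t with
  | zero => simpa using hP
  | succ t ih =>
    have ih := ih (by omega)
    have h0 := h.nonneg (by omega : j + t ≤ J)
    have h1 := h.mono (by omega : j + t ≤ j + t + 1) (by omega)
    have h2 := h.mono (by omega : j + t + 1 ≤ j + t + 2) (by omega)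
    rw [← add_assoc, sum_range_succ]
    push_cast
    have h3 : x (j + t) * x (j + t + 1) ≤ x (j + t + 1) * x (j + t + 2) := by nlinarith
    have h4 : (s + t) * (x (j + t) * x (j + t + 1)) ≤ (s + t) * (x (j + t + 1) * x (j + t + 2)) :=
      mul_le_mul_of_nonneg_left h3 (by positivity)
    have h5 : x (j + t + 1) ^ 2 ≤ x (j + t + 1) * x (j + t + 2) := by nlinarith
    have e : j + t + 1 + 1 = j + t + 2 := rfl
    rw [e]
    linarith

theorem sum_sq_le (h : IsTurn V μ x J) (hV : IsProfile V K) (hx : SolvesUpTo V μ x 0 J)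
    (hK : 2 ≤ K) (hb : b ^ 3 * V J = J) (hb1 : 1 ≤ b) {j : ℕ} (hj : j < J) :
    ∑ i ∈ range (j + 1), x i ^ 2 ≤
      (2 * K + 4) ^ 2 * √(b ^ 3) * (1 / √((J - j : ℕ) : ℝ)) * (x j * x (j + 1)) := by
  have hex := h.excess_le hV (by linarith) hb hb1
  have hb0 : 0 < b := by linarith
  have hbsq : √(b ^ 3) = b * √b := by
    rw [show b ^ 3 = b ^ 2 * b by ring, Real.sqrt_mul (by positivity), Real.sqrt_sq hb0.le]
  have far : ∀ i, i < J → 2 * (1 + K) * b ≤ (J - i : ℕ) →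
      V i ≤ μ ∧ √((J - i : ℕ) : ℝ) ≤ 2 * √(b ^ 3) * √(μ - V i) := by
    intro i hi hfar
    have h1 := hV.slope_le i J hi.le
    have hVJ := hV.pos J (by omega)
    have h2 : (J - i : ℕ) ≤ b ^ 3 * (V J - V i) := by
      have h3 : b ^ 3 * V i ≤ i := by
        refine le_of_mul_le_mul_right ?_ hVJ
        calc b ^ 3 * V i * V J = J * V i := by rw [← hb]; ring
          _ ≤ _ := h1
      rw [Nat.cast_sub hi.le]
      linarith
    have h4 : b ^ 3 * (V J - μ) ≤ (J - i : ℕ) / 2 := by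
      have : b ^ 3 * (V J - μ) = b * (b ^ 2 * (V J - μ)) := by ring
      rw [this]
      nlinarith [mul_le_mul_of_nonneg_left hex hb0.le]
    have h5 : ((J - i : ℕ) : ℝ) / 2 ≤ b ^ 3 * (μ - V i) := by linarith
    have h6 : 0 ≤ μ - V i := by
      by_contra! h7
      have : b ^ 3 * (μ - V i) < 0 := mul_neg_of_pos_of_neg (by positivity) h7
      have : (0 : ℝ) ≤ (J - i : ℕ) := by positivity
      linarith
    refine ⟨by linarith, ?_⟩
    have e : 2 * √(b ^ 3) * √(μ - V i) = √(4 * (b ^ 3 * (μ - V i))) := by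
      rw [Real.sqrt_mul (by norm_num), Real.sqrt_mul (by positivity)]
      have : √(4 : ℝ) = 2 := by
        rw [show (4 : ℝ) = 2 ^ 2 by norm_num, Real.sqrt_sq (by norm_num)]
      rw [this]
      ring
    rw [e]
    exact Real.sqrt_le_sqrt (by linarith)
  have hxx : 0 ≤ x j * x (j + 1) := mul_nonneg (h.nonneg (by omega)) (h.nonneg (by omega))
  have hJj : (0 : ℝ) < (J - j : ℕ) := by exact_mod_cast (by omega : 0 < J - j)
  have hsJ : 0 < √((J - j : ℕ) : ℝ) := Real.sqrt_pos.2 hJj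
  have farP : ∀ i, i < J → 2 * (1 + K) * b ≤ (J - i : ℕ) →
      ∑ l ∈ range (i + 1), x l ^ 2 ≤
        2 * √(b ^ 3) / √((J - i : ℕ) : ℝ) * (x i * x (i + 1)) := by
    intro i hi hfar
    obtain ⟨h1, h2⟩ := far i hi hfar
    have h3 := (h.growth hV.monotone hx hi h1).2
    have h4 : 0 < √((J - i : ℕ) : ℝ) := by
      have : (0 : ℝ) < (J - i : ℕ) := by exact_mod_cast (by omega : 0 < J - i)
      exact Real.sqrt_pos.2 this
    rw [div_mul_eq_mul_div, le_div_iff₀ h4]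
    have hP : 0 ≤ ∑ l ∈ range (i + 1), x l ^ 2 := sum_nonneg fun l _ => sq_nonneg _
    calc _ ≤ (∑ l ∈ range (i + 1), x l ^ 2) * (2 * √(b ^ 3) * √(μ - V i)) :=
          mul_le_mul_of_nonneg_left h2 hP
      _ = 2 * √(b ^ 3) * (√(μ - V i) * ∑ l ∈ range (i + 1), x l ^ 2) := by ring
      _ ≤ _ := mul_le_mul_of_nonneg_left h3 (by positivity)
  have hb3 : 0 ≤ √(b ^ 3) := Real.sqrt_nonneg _
  rcases le_or_gt (2 * (1 + K) * b) (J - j : ℕ) with hfar | hnear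
  · refine (farP j hj hfar).trans (mul_le_mul_of_nonneg_right ?_ hxx)
    rw [div_eq_mul_one_div]
    refine mul_le_mul_of_nonneg_right (mul_le_mul_of_nonneg_right ?_ hb3) (by positivity)
    nlinarith
  · set r := ⌈2 * (1 + K) * b⌉₊ with hr
    have hr1 : 2 * (1 + K) * b ≤ r := Nat.le_ceil _
    have hr2 : (r : ℝ) < 2 * (1 + K) * b + 1 := Nat.ceil_lt_add_one (by positivity)
    have hjr : J - j ≤ r := by exact_mod_cast (hnear.le.trans hr1)
    have hP : ∑ i ∈ range (j + 1), x i ^ 2 ≤ ((2 * K + 4) * b) * (x j * x (j + 1)) := by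
      rcases le_or_gt r J with hrJ | hrJ
      · have e : j = (J - r) + (j - (J - r)) := by omega
        have hr0 : 0 < r := by
          have : (0 : ℝ) < r := lt_of_lt_of_le (by positivity) hr1
          exact_mod_cast this
        have e2 : J - (J - r) = r := by omega
        have h1 := farP (J - r) (by omega) (by rw [e2]; exact hr1)
        rw [e2] at h1
        have h2 := h.sum_sq_le_add (j := J - r) (t := j - (J - r)) (by omega) (by positivity) h1
        rw [← e] at h2
        refine h2.trans (mul_le_mul_of_nonneg_right ?_ hxx)
        have h3 : 2 * √(b ^ 3) / √(r : ℝ) ≤ b := by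
          have hsr : 0 < √(r : ℝ) := Real.sqrt_pos.2 (by exact_mod_cast hr0)
          rw [div_le_iff₀ hsr, hbsq]
          have : 2 * √b ≤ √(r : ℝ) := by
            have : 2 * √b = √(4 * b) := by
              rw [Real.sqrt_mul (by norm_num)]
              rw [show (4 : ℝ) = 2 ^ 2 by norm_num, Real.sqrt_sq (by norm_num)]
            rw [this]
            exact Real.sqrt_le_sqrt (by nlinarith)
          nlinarith
        have h4 : ((j - (J - r) : ℕ) : ℝ) ≤ r := by exact_mod_cast (by omega)
        nlinarith
      · have h2 := h.sum_sq_le_add (j := 0) (t := j) (s := 0) (by omega) le_rfl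
          (by simp [h.zero])
        simp only [zero_add] at h2
        refine h2.trans (mul_le_mul_of_nonneg_right ?_ hxx)
        have h4 : (j : ℝ) ≤ r := by exact_mod_cast (by omega)
        nlinarith
    refine hP.trans (mul_le_mul_of_nonneg_right ?_ hxx)
    rw [mul_one_div, le_div_iff₀ hsJ, hbsq]
    have h1 : √((J - j : ℕ) : ℝ) ≤ (2 * K + 4) * √b := by
      have : (2 * K + 4) * √b = √((2 * K + 4) ^ 2 * b) := by
        rw [Real.sqrt_mul (by positivity), Real.sqrt_sq (by linarith)]
      rw [this]
      refine Real.sqrt_le_sqrt (hnear.le.trans (mul_le_mul_of_nonneg_right ?_ hb0.le))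
      nlinarith
    have := mul_le_mul_of_nonneg_left h1 (by positivity : 0 ≤ (2 * K + 4) * b)
    linarith

/-- Summed over the initial stretch, the relative partial sums of squares are `O(b ^ 3)`. -/
theorem sum_weights_le (h : IsTurn V μ x J) {B : ℝ} (hV : IsProfile V K)
    (hb : b ^ 3 * V J = J) (hB1 : 1 ≤ B) (hB : V J ≤ B) :
    ∑ j ∈ range J, (2 * K + 4) ^ 2 * √(b ^ 3) * (1 / √((J - j : ℕ) : ℝ)) ≤
      2 * (2 * K + 4) ^ 2 * B * b ^ 3 := by
  have hb0 := h.pos_scale hV hb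
  rw [← mul_sum]
  have h1 := sum_range_inv_sqrt_le J
  have h2 : √(J : ℝ) ≤ B * √(b ^ 3) := by
    have : B * √(b ^ 3) = √(B ^ 2 * b ^ 3) := by
      rw [Real.sqrt_mul (by positivity), Real.sqrt_sq (by linarith)]
    rw [this]
    refine Real.sqrt_le_sqrt ?_
    rw [← hb, mul_comm]
    exact mul_le_mul_of_nonneg_right (by nlinarith) (by positivity)
  have h3 := Real.mul_self_sqrt (by positivity : 0 ≤ b ^ 3)
  calc _ ≤ (2 * K + 4) ^ 2 * √(b ^ 3) * (2 * (B * √(b ^ 3))) :=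
        mul_le_mul_of_nonneg_left (by linarith) (by positivity)
    _ = 2 * (2 * K + 4) ^ 2 * B * (√(b ^ 3) * √(b ^ 3)) := by ring
    _ = _ := by rw [h3]

/-- Stability of the initial stretch: up to scaling, a solution `x'` of a perturbed recurrence is
relatively close to `x`. The residual of `x` in the perturbed recurrence is at most `κ x`. -/
theorem abs_sub_le (h : IsTurn V μ x J) {x' d e s : ℕ → ℝ} {lam κ T : ℝ} (hx'0 : x' 0 = 0)
    (hx'1 : 0 < x' 1)
    (hx' : ∀ j < J, e (j + 1) * x' (j + 2) + e j * x' j + d (j + 1) * x' (j + 1)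
      = lam * x' (j + 1)) (he : ∀ j, 1 / 2 ≤ e j) (hκ : 0 ≤ κ)
    (hres : ∀ j, j + 1 < J →
      |(lam - d (j + 1)) * x (j + 1) - e (j + 1) * x (j + 2) - e j * x j| ≤ κ * x (j + 1))
    (hs0 : ∀ j, 0 ≤ s j)
    (hs : ∀ j < J, ∑ i ∈ range (j + 1), x i ^ 2 ≤ s j * (x j * x (j + 1)))
    (hT : ∑ j ∈ range J, s j ≤ T) (hκT : 4 * κ * T ≤ 1) {j : ℕ} (hj : j ≤ J) :
    |x' j - x' 1 / x 1 * x j| ≤ 4 * κ * T * (x' 1 / x 1 * x j) := by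
  have hJ2 := h.two_le
  have hx1 := h.pos le_rfl (by omega : 1 ≤ J)
  set q := x' 1 / x 1 with hq
  have hq0 : 0 < q := by positivity
  have hpart : ∀ i ≤ J, ∑ l ∈ range i, s l ≤ T := fun i hi =>
    (sum_le_sum_of_subset_of_nonneg (range_subset_range.2 hi) fun l _ _ => hs0 l).trans hT
  have main : ∀ j ≤ J, ∀ i ≤ j, |x' i - q * x i| ≤ 4 * κ * (∑ l ∈ range i, s l) * (q * x i) := by
    intro j
    induction j with
    | zero =>
      intro _ i hi
      have : i = 0 := by omega
      simp [this, h.zero, hx'0]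
    | succ j ih =>
      intro hj i hi
      have ih := ih (by omega)
      rcases Nat.lt_or_ge i (j + 1) with hi' | hi'
      · exact ih i (by omega)
      obtain rfl : i = j + 1 := by omega
      have hsize : ∀ i ≤ j, |x' i| ≤ 2 * (q * x i) := by
        intro i hi
        have h1 := ih i hi
        have h2 : 0 ≤ q * x i := mul_nonneg hq0.le (h.nonneg (by omega))
        have h3 : 4 * κ * (∑ l ∈ range i, s l) ≤ 1 :=
          (mul_le_mul_of_nonneg_left (hpart i (by omega)) (by positivity)).trans hκT
        have h4 := h1.trans (mul_le_mul_of_nonneg_right h3 h2)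
        have h5 := abs_sub_abs_le_abs_sub (x' i) (q * x i)
        rw [abs_of_nonneg h2] at h5
        linarith
      have hW : ∀ i ≤ j, |e i * (x i * x' (i + 1) - x (i + 1) * x' i)| ≤
          2 * κ * q * ∑ l ∈ range (i + 1), x l ^ 2 := by
        intro i
        induction i with
        | zero => simp [h.zero, hx'0]
        | succ i ihi =>
          intro hij
          have ihi := ihi (by omega)
          have e1 : e (i + 1) * (x (i + 1) * x' (i + 2) - x (i + 2) * x' (i + 1)) =
              e i * (x i * x' (i + 1) - x (i + 1) * x' i) + x' (i + 1) *
                ((lam - d (i + 1)) * x (i + 1) - e (i + 1) * x (i + 2) - e i * x i) := by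
            linear_combination x (i + 1) * hx' i (by omega)
          rw [e1, sum_range_succ]
          refine (abs_add_le _ _).trans ?_
          rw [abs_mul (x' (i + 1))]
          have h1 := hsize (i + 1) hij
          have h2 := hres i (by omega)
          have h3 := h.nonneg (by omega : i + 1 ≤ J)
          have h4 := mul_le_mul h1 h2 (abs_nonneg _) (by positivity)
          linarith
      rcases Nat.eq_zero_or_pos j with rfl | hj0
      · have : x' (0 + 1) - q * x (0 + 1) = 0 := by
          simp only [zero_add, hq]
          field_simp
          ring
        rw [this, abs_zero]
        have h1 := h.nonneg hj
        have h2 := hs0 0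
        simp only [zero_add, sum_range_one] at *
        positivity
      · have h1 := hW j le_rfl
        have h2 := hs j (by omega)
        have hxj := h.pos hj0 (by omega)
        have hxj1 := h.pos (by omega : 1 ≤ j + 1) hj
        have h3 : |x j * x' (j + 1) - x (j + 1) * x' j| ≤
            4 * κ * q * (s j * (x j * x (j + 1))) := by
          rw [abs_mul, abs_of_nonneg (by linarith [he j])] at h1
          have h4 := mul_le_mul_of_nonneg_left h2 (by positivity : 0 ≤ 2 * κ * q)
          have h5 := mul_le_mul_of_nonneg_right (he j)
            (abs_nonneg (x j * x' (j + 1) - x (j + 1) * x' j))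
          linarith
        have h4 := ih j le_rfl
        refine le_of_mul_le_mul_left ?_ hxj
        have e2 : x j * |x' (j + 1) - q * x (j + 1)| =
            |(x j * x' (j + 1) - x (j + 1) * x' j) + x (j + 1) * (x' j - q * x j)| := by
          rw [← abs_of_pos hxj, ← abs_mul, abs_of_pos hxj]
          congr 1
          ring
        rw [e2, sum_range_succ]
        refine (abs_add_le _ _).trans ?_
        rw [abs_mul (x (j + 1)), abs_of_pos hxj1]
        have h5 := mul_le_mul_of_nonneg_left h4 hxj1.le
        linarith
  refine (main j hj j le_rfl).trans (mul_le_mul_of_nonneg_right ?_ ?_)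
  · exact mul_le_mul_of_nonneg_left (hpart j hj) (by positivity)
  · exact mul_nonneg hq0.le (h.nonneg hj)

end IsTurn

theorem sum_abs_mul_abs_le (s : Finset ℕ) (u v : ℕ → ℝ) {p q : ℝ} (hp : 0 ≤ p) (hq : 0 ≤ q)
    (hu : ∑ j ∈ s, u j ^ 2 ≤ p ^ 2) (hv : ∑ j ∈ s, v j ^ 2 ≤ q ^ 2) :
    ∑ j ∈ s, |u j| * |v j| ≤ p * q := by
  have h1 := Finset.sum_mul_sq_le_sq_mul_sq s (fun j => |u j|) (fun j => |v j|)
  simp only [sq_abs] at h1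
  refine le_of_pow_le_pow_left₀ two_ne_zero (by positivity) ?_
  rw [mul_pow]
  exact h1.trans (mul_le_mul hu hv (sum_nonneg fun j _ => sq_nonneg _) (by positivity))

theorem sum_range_succ_sq_le {y : ℕ → ℝ} (n : ℕ) :
    ∑ j ∈ range n, y (j + 1) ^ 2 ≤ ∑ j ∈ range (n + 1), y j ^ 2 := by
  rw [sum_range_succ']
  linarith [sq_nonneg (y 0)]

theorem sum_range_add_two_sq_le {y : ℕ → ℝ} {n : ℕ} (hy : y (n + 1) = 0) :
    ∑ j ∈ range n, y (j + 2) ^ 2 ≤ ∑ j ∈ range (n + 1), y j ^ 2 := by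
  have h1 := sum_range_succ_sq_le (y := fun j => y (j + 1)) n
  have h2 := sum_range_succ_sq_le (y := y) (n + 1)
  rw [sum_range_succ (fun j => y j ^ 2) (n + 1), hy] at h2
  simp only [add_assoc, one_add_one_eq_two] at h1
  linarith

theorem sum_range_sq_le {y : ℕ → ℝ} (n : ℕ) :
    ∑ j ∈ range n, y j ^ 2 ≤ ∑ j ∈ range (n + 1), y j ^ 2 := by
  rw [sum_range_succ]
  linarith [sq_nonneg (y n)]

theorem sum_diff_sq_le {y : ℕ → ℝ} {n : ℕ} (hy : y (n + 1) = 0) :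
    ∑ j ∈ range n, (y (j + 2) - y j) ^ 2 ≤ 4 * ∑ j ∈ range (n + 1), y j ^ 2 := by
  have h1 : ∑ j ∈ range n, (y (j + 2) - y j) ^ 2 ≤
      ∑ j ∈ range n, (2 * y (j + 2) ^ 2 + 2 * y j ^ 2) :=
    sum_le_sum fun j _ => by nlinarith [sq_nonneg (y (j + 2) + y j)]
  rw [sum_add_distrib, ← mul_sum, ← mul_sum] at h1
  linarith [sum_range_add_two_sq_le hy, sum_range_sq_le (y := y) n]

theorem sum_three_sq_le {y : ℕ → ℝ} {n : ℕ} (hy : y (n + 1) = 0) :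
    ∑ j ∈ range n, (|y (j + 2)| + |y (j + 1)| + |y j|) ^ 2 ≤ 9 * ∑ j ∈ range (n + 1), y j ^ 2 := by
  have h1 : ∑ j ∈ range n, (|y (j + 2)| + |y (j + 1)| + |y j|) ^ 2 ≤
      ∑ j ∈ range n, (3 * y (j + 2) ^ 2 + 3 * y (j + 1) ^ 2 + 3 * y j ^ 2) :=
    sum_le_sum fun j _ => by
      rw [← sq_abs (y (j + 2)), ← sq_abs (y (j + 1)), ← sq_abs (y j)]
      nlinarith [sq_nonneg (|y (j + 2)| - |y (j + 1)|), sq_nonneg (|y (j + 2)| - |y j|),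
        sq_nonneg (|y (j + 1)| - |y j|)]
  rw [sum_add_distrib, sum_add_distrib, ← mul_sum, ← mul_sum, ← mul_sum] at h1
  linarith [sum_range_add_two_sq_le hy, sum_range_succ_sq_le (y := y) n,
    sum_range_sq_le (y := y) n]

/-- The steps of a profile beyond `J / 2`. -/
theorem IsProfile.one_le_step {V : ℕ → ℝ} {K b : ℝ} {J j : ℕ} (hV : IsProfile V K) (hK : 1 ≤ K)
    (hb0 : 0 < b) (hb : b ^ 3 * V J = J) (hJ : 1 ≤ J) (hj : J ≤ 2 * j) :
    1 ≤ K * b ^ 3 * (V (j + 1) - V j) := by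
  have hj0 : (0 : ℝ) < j := by exact_mod_cast (by omega : 0 < j)
  have h1 := hV.le_step j
  have hVJ := hV.pos J hJ
  have hVj := hV.pos j (by omega)
  have hb3 : 0 < b ^ 3 := by positivity
  have h2 : (j : ℝ) ≤ K * b ^ 3 * V j := by
    rcases le_or_gt J j with h | h
    · have h3 := hV.slope_le J j h
      rw [← hb] at h3
      have h4 : (j : ℝ) ≤ b ^ 3 * V j := by
        refine le_of_mul_le_mul_right ?_ hVJ
        linarith
      have h5 : 0 < b ^ 3 * V j := by positivity
      nlinarith
    · have h3 := mul_le_mul_of_nonneg_left (hV.le_of_le_two_mul j J hj) hb3.le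
      rw [hb] at h3
      have h4 : (j : ℝ) ≤ J := by exact_mod_cast h.le
      linarith
  refine le_of_mul_le_mul_left ?_ hj0
  have h3 : 0 < K * b ^ 3 := by positivity
  nlinarith [mul_le_mul_of_nonneg_left h1 h3.le]

/-- Two-sided bound for the mass of a solution of the inhomogeneous recurrence by its size at one
index `m` and the total mass. -/
theorem IsProfile.mass_le {V y f z : ℕ → ℝ} {μ K b ε Y : ℝ} {J m n : ℕ} (hV : IsProfile V K)
    (hK : 2 ≤ K) (hμ : 0 ≤ μ) (hμK : 3 + μ ≤ K) (hb1 : 1 ≤ b) (hb : b ^ 3 * V J = J) (hJ : 1 ≤ J)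
    (hJm : J ≤ m) (hmn : m ≤ n) (hμm : μ ≤ V m) (hm : V m ≤ μ + 2)
    (hm' : m = n ∨ μ + 3 / 2 ≤ V m) (hy0 : y 0 = 0) (hyn : y (n + 1) = 0)
    (hy : SolvesUpTo V μ y f n) (hε : 0 ≤ ε)
    (hf : ∀ j < n, |f (j + 1)| ≤ ε * (K + V (j + 1)) * |z j|)
    (hz : ∑ j ∈ range n, z j ^ 2 ≤ 3 ^ 2) (hY : 0 ≤ Y)
    (hyY : ∑ j ∈ range (n + 1), y j ^ 2 ≤ Y ^ 2) :
    (∑ j ∈ Ico ((J + 1) / 2) m, y j ^ 2 ≤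
      2 * K ^ 3 * b ^ 3 * (2 * (y m ^ 2 + y (m + 1) ^ 2) + 30 * K * ε * Y)) ∧
    ∑ j ∈ Ico m n, y (j + 1) ^ 2 ≤
      600 * K * b ^ 3 * (y m ^ 2 + y (m + 1) ^ 2 + 30 * K * ε * Y) + 2250 * K ^ 2 * ε ^ 2 := by
  have hb3 : 1 ≤ b ^ 3 := one_le_pow₀ hb1
  have hcs : ∑ j ∈ range n, |z j| * |y (j + 2) - y j| ≤ 3 * (2 * Y) :=
    sum_abs_mul_abs_le (range n) z (fun j => y (j + 2) - y j) (by norm_num) (by positivity) hz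
      ((sum_diff_sq_le hyn).trans (by rw [mul_pow]; linarith))
  constructor
  · have h1 := sum_mul_sq_le_of_le hV.monotone hV.zero.ge hμK hμm hm hy0
      (fun j hj => hy j (by omega) : SolvesUpTo V μ y f m)
    have h2 : ∑ j ∈ range m, |f (j + 1)| * |y (j + 2) - y j| ≤ 30 * K * ε * Y := by
      calc _ ≤ ∑ j ∈ range m, ε * (2 * K) * (|z j| * |y (j + 2) - y j|) := by
            refine sum_le_sum fun j hj => ?_
            have hj := mem_range.1 hj
            rw [← mul_assoc]
            refine mul_le_mul_of_nonneg_right ((hf j (by omega)).trans ?_) (abs_nonneg _)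
            refine mul_le_mul_of_nonneg_right ?_ (abs_nonneg _)
            have := hV.monotone (by omega : j + 1 ≤ m)
            exact mul_le_mul_of_nonneg_left (by linarith) hε
        _ ≤ ∑ j ∈ range n, ε * (2 * K) * (|z j| * |y (j + 2) - y j|) :=
            sum_le_sum_of_subset_of_nonneg (range_subset_range.2 hmn) fun j _ _ => by positivity
        _ ≤ ε * (2 * K) * (3 * (2 * Y)) := by
            rw [← mul_sum]
            exact mul_le_mul_of_nonneg_left hcs (by positivity)
        _ ≤ 30 * K * ε * Y := by
            have : 0 ≤ K * ε * Y := by positivity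
            linarith
    have h3 : ∑ j ∈ Ico ((J + 1) / 2) m, y j ^ 2 ≤
        K * b ^ 3 * ∑ j ∈ range m, (V (j + 1) - V j) * (y j ^ 2 + y (j + 1) ^ 2) := by
      rw [mul_sum]
      have h0 : ∀ j, 0 ≤ K * b ^ 3 * ((V (j + 1) - V j) * (y j ^ 2 + y (j + 1) ^ 2)) := fun j => by
        have := hV.monotone (Nat.le_succ j)
        have : 0 ≤ V (j + 1) - V j := sub_nonneg.2 this
        positivity
      calc _ ≤ ∑ j ∈ Ico ((J + 1) / 2) m,
            K * b ^ 3 * ((V (j + 1) - V j) * (y j ^ 2 + y (j + 1) ^ 2)) := by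
            refine sum_le_sum fun j hj => ?_
            have hj := mem_Ico.1 hj
            have h4 := hV.one_le_step (by linarith) (by linarith) hb hJ (by omega : J ≤ 2 * j)
            rw [← mul_assoc]
            have h5 := mul_le_mul_of_nonneg_right h4
              (by positivity : 0 ≤ y j ^ 2 + y (j + 1) ^ 2)
            linarith [sq_nonneg (y (j + 1))]
        _ ≤ _ := sum_le_sum_of_subset_of_nonneg
            (fun j hj => mem_range.2 (mem_Ico.1 hj).2) fun j _ _ => h0 j
    have h6 := mul_le_mul_of_nonneg_left (h1.trans (mul_le_mul_of_nonneg_left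
      (add_le_add_right h2 _) (by positivity))) (by positivity : 0 ≤ K * b ^ 3)
    linarith
  · rcases hm' with rfl | hm'
    · simp only [Ico_self, sum_empty]
      positivity
    have hb0 : 0 < b := by linarith
    have h1 := sum_sq_le_of_lt (V := V) (D := K * b ^ 3) (by nlinarith) hmn
      (fun j hj => hV.one_le_step (by linarith) hb0 hb hJ (by omega)) hm' hm hyn hy
    have hU : ∀ j, m ≤ j → 1 / 2 ≤ V (j + 1) - μ - 1 := fun j hj => by
      have := hV.monotone (by omega : m ≤ j + 1)
      linarith
    have hf' : ∀ j ∈ Ico m n, |f (j + 1)| / (V (j + 1) - μ - 1) ≤ 5 * K * ε * |z j| := by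
      intro j hj
      have hj := mem_Ico.1 hj
      have h2 := hU j hj.1
      rw [div_le_iff₀ (by linarith)]
      refine (hf j hj.2).trans ?_
      have h3 : K + V (j + 1) ≤ 5 * K * (V (j + 1) - μ - 1) := by nlinarith
      have := mul_le_mul_of_nonneg_left h3 (by positivity : 0 ≤ ε * |z j|)
      linarith
    have hsub : Ico m n ⊆ range n := fun j hj => mem_range.2 (mem_Ico.1 hj).2
    have h2 : ∑ j ∈ Ico m n, |f (j + 1)| / (V (j + 1) - μ - 1) * |y (j + 2) - y j| ≤
        30 * K * ε * Y := by
      calc _ ≤ ∑ j ∈ Ico m n, 5 * K * ε * (|z j| * |y (j + 2) - y j|) := by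
            refine sum_le_sum fun j hj => ?_
            rw [← mul_assoc]
            exact mul_le_mul_of_nonneg_right (hf' j hj) (abs_nonneg _)
        _ ≤ ∑ j ∈ range n, 5 * K * ε * (|z j| * |y (j + 2) - y j|) :=
            sum_le_sum_of_subset_of_nonneg hsub fun j _ _ => by positivity
        _ ≤ 5 * K * ε * (3 * (2 * Y)) := by
            rw [← mul_sum]
            exact mul_le_mul_of_nonneg_left hcs (by positivity)
        _ = 30 * K * ε * Y := by ring
    have h3 : ∑ j ∈ Ico m n, (f (j + 1) / (V (j + 1) - μ - 1)) ^ 2 ≤ 225 * K ^ 2 * ε ^ 2 := by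
      calc _ ≤ ∑ j ∈ Ico m n, (5 * K * ε) ^ 2 * z j ^ 2 := by
            refine sum_le_sum fun j hj => ?_
            have h4 := hf' j hj
            have h5 := hU j (mem_Ico.1 hj).1
            rw [← sq_abs, abs_div, abs_of_pos (by linarith : 0 < V (j + 1) - μ - 1), ← sq_abs (z j),
              ← mul_pow]
            exact pow_le_pow_left₀ (div_nonneg (abs_nonneg _) (by linarith)) h4 2
        _ ≤ ∑ j ∈ range n, (5 * K * ε) ^ 2 * z j ^ 2 :=
            sum_le_sum_of_subset_of_nonneg hsub fun j _ _ => by positivity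
        _ ≤ (5 * K * ε) ^ 2 * 3 ^ 2 := by
            rw [← mul_sum]
            exact mul_le_mul_of_nonneg_left hz (by positivity)
        _ = _ := by ring
    have h4 := mul_le_mul_of_nonneg_left h2 (by positivity : 0 ≤ 600 * K * b ^ 3)
    linarith

/-- The Wronskian of a homogeneous and an inhomogeneous solution. -/
theorem wronskian_eq {V x y f : ℕ → ℝ} {μ : ℝ} {m : ℕ} (hx : SolvesUpTo V μ x 0 m)
    (hy : SolvesUpTo V μ y f m) (hx0 : x 0 = 0) (hy0 : y 0 = 0) :
    x m * y (m + 1) - x (m + 1) * y m = ∑ j ∈ range m, x (j + 1) * f (j + 1) := by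
  induction m with
  | zero => simp [hx0, hy0]
  | succ m ih =>
    rw [sum_range_succ, ← ih (fun j hj => hx j (by omega)) fun j hj => hy j (by omega)]
    have h1 := hx m (by omega)
    have h2 := hy m (by omega)
    simp only [Pi.zero_apply, add_zero] at h1
    linear_combination x (m + 1) * h2 - y (m + 1) * h1

theorem SolvesUpTo.sub_mul {V x y f : ℕ → ℝ} {μ : ℝ} {n : ℕ} (hy : SolvesUpTo V μ y f n)
    (hx : SolvesUpTo V μ x 0 n) (r : ℝ) : SolvesUpTo V μ (fun j => y j - r * x j) f n := by
  intro j hj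
  have h1 := hx j hj
  have h2 := hy j hj
  simp only [Pi.zero_apply, add_zero] at h1
  simp only
  linear_combination h2 - r * h1

theorem sum_range_succ_eq_sum_Ico (u : ℕ → ℝ) {p m n : ℕ} (hpm : p ≤ m) (hmn : m ≤ n) :
    ∑ j ∈ range (n + 1), u j =
      ∑ j ∈ range p, u j + ∑ j ∈ Ico p m, u j + u m + ∑ j ∈ Ico m n, u (j + 1) := by
  rw [← sum_range_add_sum_Ico u (by omega : m + 1 ≤ n + 1), sum_range_succ,
    ← sum_range_add_sum_Ico u hpm, sum_Ico_add' u m n 1]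

theorem le_of_sq_le_add {Y G : ℝ} (hG : 0 ≤ G) (h : Y ^ 2 ≤ 1000000 * G ^ 2 + 4800 * (G * Y)) :
    Y ≤ 6000 * G := by
  by_contra! h1
  nlinarith

theorem abs_sq_sub_two_mul_le {Y H t : ℝ} (hY0 : 0 ≤ Y) (hY : Y ≤ 6000 * H) (hH : 10 ^ 8 * H ≤ 1)
    (ht : |t| ≤ Y) : |Y ^ 2 - 2 * t| ≤ 18000 * H := by
  have h1 := abs_le.1 ht
  rw [abs_le]
  constructor <;> nlinarith

theorem abs_sub_one_le_of_abs_sub_le {q r H : ℝ} (hq : 0 < q) (hH0 : 0 ≤ H) (hH : 10 ^ 8 * H ≤ 1)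
    (hqr : |q - r| ≤ 10 ^ 7 * H) (hr : |r ^ 2 - 1| ≤ 18000 * H) : |q - 1| ≤ 2 * 10 ^ 7 * H := by
  have h1 := abs_le.1 hqr
  have h2 := abs_le.1 hr
  have hr0 : 0 < r := by
    by_contra! h3
    nlinarith
  have h3 : r - 1 ≤ 18000 * H := by
    by_contra! h4
    nlinarith
  have h4 : -(18000 * H) ≤ r - 1 := by
    by_contra! h4
    nlinarith
  rw [abs_le]
  constructor <;> linarith

namespace IsTurn

variable {V x : ℕ → ℝ} {μ K b : ℝ} {J : ℕ}

/-- The mass of a growing solution on the first half of the initial stretch. -/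
theorem sum_range_half_le (h : IsTurn V μ x J) {m : ℕ} (hJm : J ≤ m) :
    ∑ j ∈ range ((J + 1) / 2), x j ^ 2 ≤
      ∑ j ∈ range ((J + 1) / 2), x ((J + 1) / 2 + j) ^ 2 ∧
    ∀ u : ℕ → ℝ, (∀ j, 0 ≤ u j) → ∑ j ∈ range ((J + 1) / 2), u ((J + 1) / 2 + j) ≤
      ∑ j ∈ Ico ((J + 1) / 2) m, u j + u m := by
  refine ⟨sum_le_sum fun j hj => ?_, fun u hu => ?_⟩
  · have hj := mem_range.1 hj
    exact pow_le_pow_left₀ (h.nonneg (by omega)) (h.mono (by omega) (by omega)) 2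
  · rw [← sum_Ico_succ_top (by omega), Finset.sum_Ico_eq_sum_range]
    refine sum_le_sum_of_subset_of_nonneg (range_subset_range.2 (by omega)) fun j _ _ => hu _

/-- The mass of `x` near the stopping index. -/
theorem exists_window (h : IsTurn V μ x J) (hV : IsProfile V K) (hx : SolvesUpTo V μ x 0 J)
    (hμ : 0 ≤ μ) (hK : 2 ≤ K) (hb : b ^ 3 * V J = J) (hbK : K ≤ b) :
    ∃ s ⊆ range (J + 1), b * x J ^ 2 ≤ 32 * K * ∑ i ∈ s, x i ^ 2 := by
  have hb0 : 0 < b := by linarith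
  set d := ⌊b / (8 * K)⌋₊ with hd
  have hd1 : b / (8 * K) < d + 1 := Nat.lt_floor_add_one _
  have hd2 : (d : ℝ) ≤ b / (8 * K) := Nat.floor_le (by positivity)
  rw [div_lt_iff₀ (by positivity)] at hd1
  rw [le_div_iff₀ (by positivity)] at hd2
  have hdJ : d ≤ J := by
    have h1 := h.scale_le hV hx hμ hb
    have : (d : ℝ) ≤ J := by
      have : (0 : ℝ) ≤ d := by positivity
      nlinarith
    exact_mod_cast this
  refine ⟨Ico (J - d) (J + 1), fun i hi => mem_range.2 (mem_Ico.1 hi).2, ?_⟩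
  have h1 : ∀ i ∈ Ico (J - d) (J + 1), x J ^ 2 / 4 ≤ x i ^ 2 := by
    intro i hi
    have hi := mem_Ico.1 hi
    have h2 := h.half_le hV hx hμ hK hb hbK (t := J - i) (by
      have : ((J - i : ℕ) : ℝ) ≤ d := by exact_mod_cast (by omega)
      nlinarith)
    have e : J - (J - i) = i := by omega
    rw [e] at h2
    have := pow_le_pow_left₀ (h.nonneg le_rfl) h2 2
    linarith
  have h2 := Finset.card_nsmul_le_sum _ _ _ h1
  rw [Nat.card_Ico, nsmul_eq_mul] at h2
  have e : ((J + 1 - (J - d) : ℕ) : ℝ) = d + 1 := by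
    rw [show J + 1 - (J - d) = d + 1 by omega]
    push_cast
    ring
  rw [e] at h2
  have h3 := mul_le_mul_of_nonneg_right hd1.le (sq_nonneg (x J))
  have h4 := mul_le_mul_of_nonneg_left h2 (by positivity : 0 ≤ 32 * K)
  linarith

/-- A lower bound for the amplitude of a normalized solution. -/
theorem one_le_amplitude (h : IsTurn V μ x J) (hV : IsProfile V K) {m n : ℕ}
    (hK : 2 ≤ K) (hμ : 0 ≤ μ) (hμK : 3 + μ ≤ K) (hb1 : 1 ≤ b) (hb : b ^ 3 * V J = J)
    (hJm : J ≤ m) (hmn : m ≤ n) (hm : V m ≤ μ + 2) (hm' : m = n ∨ μ + 3 / 2 ≤ V m)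
    (hxn : x (n + 1) = 0) (hx : SolvesUpTo V μ x 0 n)
    (hnorm : ∑ j ∈ range (n + 1), x j ^ 2 = 1) :
    1 ≤ 160 * K ^ 3 * b ^ 3 * (x m ^ 2 + x (m + 1) ^ 2) := by
  have hJ := h.two_le
  have hμJ := h.lt_apply fun j hj => hx j (by omega)
  obtain ⟨h1, h2⟩ := hV.mass_le (f := 0) (z := 0) (ε := 0) (Y := 1) hK hμ hμK hb1 hb (by omega)
    hJm hmn (hμJ.le.trans (hV.monotone hJm)) hm hm' h.zero hxn hx le_rfl (by simp) (by simp)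
    (by norm_num) (by simp [hnorm])
  obtain ⟨h3, h4⟩ := h.sum_range_half_le hJm
  have h4 := h4 (fun j => x j ^ 2) fun j => sq_nonneg _
  rw [sum_range_succ_eq_sum_Ico (fun j => x j ^ 2) (by omega : (J + 1) / 2 ≤ m) hmn] at hnorm
  have hb3 : 1 ≤ b ^ 3 := one_le_pow₀ hb1
  set A := x m ^ 2 + x (m + 1) ^ 2 with hA
  have hxA : x m ^ 2 ≤ A := by
    rw [hA]
    linarith [sq_nonneg (x (m + 1))]
  have hA0 : 0 ≤ A := (sq_nonneg _).trans hxA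
  have hbA : A ≤ b ^ 3 * A := le_mul_of_one_le_left hA0 hb3
  have hK3 : 4 * (K * (b ^ 3 * A)) ≤ K ^ 3 * (b ^ 3 * A) := by
    have h0 : 0 ≤ b ^ 3 * A := by positivity
    rw [← mul_assoc]
    exact mul_le_mul_of_nonneg_right (by nlinarith) h0
  have hK1 : 2 * (b ^ 3 * A) ≤ K * (b ^ 3 * A) :=
    mul_le_mul_of_nonneg_right hK (by positivity)
  simp only [mul_zero, zero_mul, add_zero, ne_eq, OfNat.ofNat_ne_zero, not_false_eq_true,
    zero_pow] at h1 h2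
  linarith

set_option maxHeartbeats 1000000 in
/-- The relative deviation, on the initial stretch, of a perturbed normalized solution `x'` from a
normalized solution `x`, when the two are known to be nearly proportional on that stretch. -/
theorem abs_sub_le_of_proportional (h : IsTurn V μ x J) (hV : IsProfile V K) {m n : ℕ}
    {x' f : ℕ → ℝ} {ε q : ℝ}
    (hK : 2 ≤ K) (hμ : 0 ≤ μ) (hμK : 3 + μ ≤ K) (hbK : K ≤ b) (hb : b ^ 3 * V J = J)
    (hJm : J ≤ m) (hmn : m ≤ n) (hm : V m ≤ μ + 2) (hm' : m = n ∨ μ + 3 / 2 ≤ V m)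
    (hxn : x (n + 1) = 0) (hx : SolvesUpTo V μ x 0 n)
    (hnorm : ∑ j ∈ range (n + 1), x j ^ 2 = 1)
    (hx'0 : x' 0 = 0) (hx'n : x' (n + 1) = 0) (hx' : SolvesUpTo V μ x' f n)
    (hnorm' : ∑ j ∈ range (n + 1), x' j ^ 2 = 1) (hε : 0 ≤ ε)
    (hf : ∀ j < n, |f (j + 1)| ≤ ε * (K + V (j + 1)) * (|x' (j + 2)| + |x' (j + 1)| + |x' j|))
    (hq : 0 < q) (hqx : ∀ j ≤ J, |x' j - q * x j| ≤ K * ε * b ^ 3 * (q * x j))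
    (hsmall : 10 ^ 8 * K ^ 7 * ε * b ^ 4 ≤ 1) {j : ℕ} (hj : j ≤ J) :
    |x' j - x j| ≤ 10 ^ 8 * K ^ 7 * ε * b ^ 4 * x j := by
  have hb1 : 1 ≤ b := by linarith
  have hb0 : 0 < b := by linarith
  have hb3 : 1 ≤ b ^ 3 := one_le_pow₀ hb1
  have hK0 : 0 < K := by linarith
  have hJ := h.two_le
  have hxJ : SolvesUpTo V μ x 0 J := fun j hj => hx j (by omega)
  have hxm : SolvesUpTo V μ x 0 m := fun j hj => hx j (by omega)
  have hμJ := h.lt_apply hxJ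
  set z : ℕ → ℝ := fun j => |x' (j + 2)| + |x' (j + 1)| + |x' j| with hz
  have hz0 : ∀ j, 0 ≤ z j := fun j => by simp only [hz]; positivity
  have hz9 : ∑ j ∈ range n, z j ^ 2 ≤ 3 ^ 2 :=
    (sum_three_sq_le hx'n).trans (by rw [hnorm']; norm_num)
  have hf' : ∀ j < n, |f (j + 1)| ≤ ε * (K + V (j + 1)) * |z j| := fun j hj => by
    rw [abs_of_nonneg (hz0 j)]
    exact hf j hj
  have hamp := h.one_le_amplitude hV hK hμ hμK hb1 hb hJm hmn hm hm' hxn hx hnorm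
  set A := x m ^ 2 + x (m + 1) ^ 2 with hA
  have hA0 : 0 < A := by
    by_contra! hcon
    have : 160 * K ^ 3 * b ^ 3 * A ≤ 0 := mul_nonpos_of_nonneg_of_nonpos (by positivity) hcon
    linarith
  -- the component of `x'` along `x` near `m`, and the remainder `y`
  set r := (x m * x' m + x (m + 1) * x' (m + 1)) / A with hr
  set y : ℕ → ℝ := fun j => x' j - r * x j with hy
  have hyf : SolvesUpTo V μ y f n := hx'.sub_mul hx r
  have hy0 : y 0 = 0 := by simp [hy, hx'0, h.zero]
  have hyn : y (n + 1) = 0 := by simp [hy, hx'n, hxn]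
  have hW : |x m * x' (m + 1) - x (m + 1) * x' m| ≤ 6 * K * ε := by
    rw [wronskian_eq hxm (fun j hj => hx' j (by omega)) h.zero hx'0]
    calc _ ≤ ∑ j ∈ range m, |x (j + 1) * f (j + 1)| := abs_sum_le_sum_abs _ _
      _ ≤ ∑ j ∈ range m, 2 * K * ε * (|x (j + 1)| * |z j|) := by
          refine sum_le_sum fun j hj => ?_
          have hj := mem_range.1 hj
          rw [abs_mul]
          have h1 := hV.monotone (by omega : j + 1 ≤ m)
          have h2 : ε * (K + V (j + 1)) * |z j| ≤ ε * (2 * K) * |z j| :=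
            mul_le_mul_of_nonneg_right (mul_le_mul_of_nonneg_left (by linarith) hε) (abs_nonneg _)
          have h3 := mul_le_mul_of_nonneg_left ((hf' j (by omega)).trans h2)
            (abs_nonneg (x (j + 1)))
          linarith
      _ ≤ ∑ j ∈ range n, 2 * K * ε * (|x (j + 1)| * |z j|) :=
          sum_le_sum_of_subset_of_nonneg (range_subset_range.2 hmn) fun j _ _ => by positivity
      _ ≤ 2 * K * ε * (1 * 3) := by
          rw [← mul_sum]
          refine mul_le_mul_of_nonneg_left ?_ (by positivity)
          refine sum_abs_mul_abs_le (range n) (fun j => x (j + 1)) z (by norm_num) (by norm_num)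
            ?_ hz9
          rw [one_pow, ← hnorm]
          exact sum_range_succ_sq_le n
      _ = 6 * K * ε := by ring
  have hyA : y m ^ 2 + y (m + 1) ^ 2 ≤ 5760 * K ^ 5 * ε ^ 2 * b ^ 3 := by
    have h1 : (y m ^ 2 + y (m + 1) ^ 2) * A = (x m * x' (m + 1) - x (m + 1) * x' m) ^ 2 := by
      have h2 : r * A = x m * x' m + x (m + 1) * x' (m + 1) := by
        rw [hr]
        field_simp
      simp only [hy]
      have h3 : x m ^ 2 + x (m + 1) ^ 2 = A := rfl
      have h4 : ((x' m - r * x m) ^ 2 + (x' (m + 1) - r * x (m + 1)) ^ 2) * A =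
          (x' m ^ 2 + x' (m + 1) ^ 2) * (x m ^ 2 + x (m + 1) ^ 2)
            - 2 * (r * A) * (x m * x' m + x (m + 1) * x' (m + 1)) + (r * A) ^ 2 := by
        rw [h3]
        linear_combination r ^ 2 * A * h3
      rw [h4, h2]
      ring
    have h2 : (x m * x' (m + 1) - x (m + 1) * x' m) ^ 2 ≤ (6 * K * ε) ^ 2 := by
      rw [← sq_abs]
      exact pow_le_pow_left₀ (abs_nonneg _) hW 2
    rw [← h1] at h2
    calc _ ≤ (y m ^ 2 + y (m + 1) ^ 2) * (160 * K ^ 3 * b ^ 3 * A) :=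
          le_mul_of_one_le_right (by positivity) hamp
      _ = 160 * K ^ 3 * b ^ 3 * ((y m ^ 2 + y (m + 1) ^ 2) * A) := by ring
      _ ≤ 160 * K ^ 3 * b ^ 3 * (6 * K * ε) ^ 2 := mul_le_mul_of_nonneg_left h2 (by positivity)
      _ = _ := by ring
  set E := ε * b ^ 3 with hE
  have hE0 : 0 ≤ E := by positivity
  have hεE : ε ≤ E := le_mul_of_one_le_right hε hb3
  set Y := √(∑ j ∈ range (n + 1), y j ^ 2) with hY
  have hY0 : 0 ≤ Y := Real.sqrt_nonneg _
  have hY2 : Y ^ 2 = ∑ j ∈ range (n + 1), y j ^ 2 :=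
    Real.sq_sqrt (sum_nonneg fun j _ => sq_nonneg _)
  obtain ⟨hN, hR⟩ := hV.mass_le hK hμ hμK hb1 hb (by omega) hJm hmn
    (hμJ.le.trans (hV.monotone hJm)) hm hm' hy0 hyn hyf hε hf' hz9 hY0 hY2.ge
  obtain ⟨hhalf1, hhalf2⟩ := h.sum_range_half_le hJm
  have hhalf2 := hhalf2 (fun j => y j ^ 2) fun j => sq_nonneg _
  -- deviations from proportionality on the initial stretch
  set w : ℕ → ℝ := fun j => x' j - q * x j with hw
  have hKE : K * E ≤ 1 / 2 := by
    have h1 : K * E ≤ K ^ 7 * ε * b ^ 4 := by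
      rw [hE]
      calc K * (ε * b ^ 3) = K * 1 * (ε * b ^ 3) * 1 := by ring
        _ ≤ K * K ^ 6 * (ε * b ^ 3) * b := by
            gcongr
            exact one_le_pow₀ (by linarith)
        _ = _ := by ring
    linarith
  have hwj : ∀ j ≤ J, w j ^ 2 ≤ (2 * K * E * x' j) ^ 2 := by
    intro j hj
    have h1 := hqx j hj
    have h2 : 0 ≤ q * x j := mul_nonneg hq.le (h.nonneg hj)
    have h3 : K * ε * b ^ 3 * (q * x j) = K * E * (q * x j) := by rw [hE]; ring
    rw [h3] at h1
    have h4 : q * x j ≤ 2 * x' j := by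
      have h5 := (abs_le.1 h1).1
      have h6 := mul_le_mul_of_nonneg_right hKE h2
      linarith
    rw [← sq_abs]
    refine pow_le_pow_left₀ (abs_nonneg _) (h1.trans ?_) 2
    have := mul_le_mul_of_nonneg_left h4 (by positivity : 0 ≤ K * E)
    linarith
  have hwsum : ∀ s ⊆ range (J + 1), ∑ j ∈ s, w j ^ 2 ≤ 4 * K ^ 2 * E ^ 2 := by
    intro s hs
    calc _ ≤ ∑ j ∈ s, (2 * K * E) ^ 2 * x' j ^ 2 := sum_le_sum fun j hj => by
            rw [← mul_pow]
            exact hwj j (by have := mem_range.1 (hs hj); omega)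
      _ ≤ ∑ j ∈ range (n + 1), (2 * K * E) ^ 2 * x' j ^ 2 :=
          sum_le_sum_of_subset_of_nonneg (hs.trans (range_subset_range.2 (by omega)))
            fun j _ _ => by positivity
      _ = _ := by
          rw [← mul_sum, hnorm']
          ring
  have hyw : ∀ j, y j = (q - r) * x j + w j := fun j => by
    simp only [hy, hw]
    ring
  have hle : ∀ s ⊆ range (J + 1), (q - r) ^ 2 * ∑ j ∈ s, x j ^ 2 ≤
      2 * ∑ j ∈ s, y j ^ 2 + 8 * K ^ 2 * E ^ 2 := by
    intro s hs
    have h1 : (q - r) ^ 2 * ∑ j ∈ s, x j ^ 2 ≤ ∑ j ∈ s, (2 * y j ^ 2 + 2 * w j ^ 2) := by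
      rw [mul_sum]
      refine sum_le_sum fun j _ => ?_
      rw [hyw j]
      linarith [sq_nonneg ((q - r) * x j + 2 * w j)]
    rw [sum_add_distrib, ← mul_sum, ← mul_sum] at h1
    linarith [hwsum s hs]
  have hfirst : ∑ j ∈ range ((J + 1) / 2), y j ^ 2 ≤
      4 * (∑ j ∈ Ico ((J + 1) / 2) m, y j ^ 2 + y m ^ 2) + 24 * K ^ 2 * E ^ 2 := by
    have h1 : ∑ j ∈ range ((J + 1) / 2), y j ^ 2 ≤
        2 * ((q - r) ^ 2 * ∑ j ∈ range ((J + 1) / 2), x j ^ 2) +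
          2 * ∑ j ∈ range ((J + 1) / 2), w j ^ 2 := by
      rw [mul_sum, mul_sum, mul_sum, ← sum_add_distrib]
      refine sum_le_sum fun j _ => ?_
      rw [hyw j]
      linarith [sq_nonneg ((q - r) * x j - w j)]
    have h2 := hwsum (range ((J + 1) / 2)) (range_subset_range.2 (by omega))
    have h3 := hle (Ico ((J + 1) / 2) ((J + 1) / 2 + (J + 1) / 2)) fun j hj => by
      have := mem_Ico.1 hj
      exact mem_range.2 (by omega)
    rw [sum_Ico_eq_sum_range, sum_Ico_eq_sum_range, Nat.add_sub_cancel_left] at h3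
    have h4 := mul_le_mul_of_nonneg_left hhalf1 (sq_nonneg (q - r))
    linarith
  -- the total remainder
  have hYle : Y ≤ 6000 * K ^ 4 * E := by
    rw [sum_range_succ_eq_sum_Ico (fun j => y j ^ 2) (by omega : (J + 1) / 2 ≤ m) hmn] at hY2
    have hyA0 : y m ^ 2 ≤ y m ^ 2 + y (m + 1) ^ 2 := by linarith [sq_nonneg (y (m + 1))]
    set a := y m ^ 2 + y (m + 1) ^ 2 with ha
    have ha0 : 0 ≤ a := by positivity
    have hba : a ≤ b ^ 3 * a := le_mul_of_one_le_left ha0 hb3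
    have hbaE : b ^ 3 * a ≤ 5760 * K ^ 5 * E ^ 2 := by
      calc b ^ 3 * a ≤ b ^ 3 * (5760 * K ^ 5 * ε ^ 2 * b ^ 3) :=
            mul_le_mul_of_nonneg_left hyA (by positivity)
        _ = _ := by rw [hE]; ring
    have hε2 : ε ^ 2 ≤ E ^ 2 := pow_le_pow_left₀ hε hεE 2
    have hεK : K ^ 2 * ε ^ 2 ≤ K ^ 2 * E ^ 2 := mul_le_mul_of_nonneg_left hε2 (by positivity)
    have e1 : b ^ 3 * (30 * K * ε * Y) = 30 * K * (E * Y) := by rw [hE]; ring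
    have h1 : Y ^ 2 ≤ (20 * K ^ 3 + 5 + 600 * K) * (b ^ 3 * a) + 2274 * (K ^ 2 * E ^ 2)
        + (10 * K ^ 3 + 600 * K) * (b ^ 3 * (30 * K * ε * Y)) := by
      linarith
    rw [e1] at h1
    set G := K ^ 4 * E with hG
    have hG0 : 0 ≤ G := by positivity
    have hK3 : 4 * K ≤ K ^ 3 := by
      have h0 : 0 ≤ K * ((K - 2) * (K + 2)) :=
        mul_nonneg hK0.le (mul_nonneg (by linarith) (by linarith))
      linarith
    have hcoef : 20 * K ^ 3 + 5 + 600 * K ≤ 171 * K ^ 3 := by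
      linarith
    have hcoef2 : 10 * K ^ 3 + 600 * K ≤ 160 * K ^ 3 := by
      linarith
    have h2 : (20 * K ^ 3 + 5 + 600 * K) * (b ^ 3 * a) ≤ 171 * K ^ 3 * (5760 * K ^ 5 * E ^ 2) :=
      mul_le_mul hcoef hbaE (by positivity) (by positivity)
    have h3 : (10 * K ^ 3 + 600 * K) * (30 * K * (E * Y)) ≤ 160 * K ^ 3 * (30 * K * (E * Y)) :=
      mul_le_mul_of_nonneg_right hcoef2 (by positivity)
    have h4 : K ^ 2 * E ^ 2 ≤ G ^ 2 := by
      rw [hG, mul_pow (K ^ 4) E]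
      refine mul_le_mul_of_nonneg_right ?_ (sq_nonneg _)
      rw [← pow_mul]
      exact pow_le_pow_right₀ (by linarith) (by norm_num)
    have e2 : 171 * K ^ 3 * (5760 * K ^ 5 * E ^ 2) = 984960 * G ^ 2 := by rw [hG]; ring
    have e3 : 160 * K ^ 3 * (30 * K * (E * Y)) = 4800 * (G * Y) := by rw [hG]; ring
    have h5 : Y ^ 2 ≤ 1000000 * G ^ 2 + 4800 * (G * Y) := by linarith [sq_nonneg G]
    have e4 : 6000 * K ^ 4 * E = 6000 * G := by rw [hG]; ring
    rw [e4]
    exact le_of_sq_le_add hG0 h5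
  set H := K ^ 7 * ε * b ^ 4 with hH
  have hH1 : 10 ^ 8 * H ≤ 1 := by
    rw [hH]
    linarith
  have hKEH : K ^ 4 * E ≤ H := by
    rw [hH, hE]
    calc K ^ 4 * (ε * b ^ 3) = K ^ 4 * 1 * (ε * b ^ 3) * 1 := by ring
      _ ≤ K ^ 4 * K ^ 3 * (ε * b ^ 3) * b := by
          gcongr
          exact one_le_pow₀ (by linarith)
      _ = _ := by ring
  have hYH : Y ≤ 6000 * H := by linarith
  have hH0 : 0 ≤ H := by positivity
  -- the factors `r` and `q` are close to `1`
  have hr2 : |r ^ 2 - 1| ≤ 18000 * H := by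
    have h1 : r ^ 2 - 1 = Y ^ 2 - 2 * ∑ j ∈ range (n + 1), x' j * y j := by
      have h2 : ∑ j ∈ range (n + 1), (r * x j) ^ 2 = r ^ 2 := by
        simp only [mul_pow]
        rw [← mul_sum, hnorm, mul_one]
      have h3 : ∑ j ∈ range (n + 1), (r * x j) ^ 2 =
          ∑ j ∈ range (n + 1), x' j ^ 2 + ∑ j ∈ range (n + 1), y j ^ 2
            - 2 * ∑ j ∈ range (n + 1), x' j * y j := by
        rw [mul_sum, ← sum_add_distrib, ← sum_sub_distrib]
        refine sum_congr rfl fun j _ => ?_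
        simp only [hy]
        ring
      rw [← h2, h3, hnorm', hY2]
      ring
    have h2 : |∑ j ∈ range (n + 1), x' j * y j| ≤ 1 * Y := by
      refine (abs_sum_le_sum_abs _ _).trans ?_
      simp only [abs_mul]
      exact sum_abs_mul_abs_le _ x' y (by norm_num) hY0 (by rw [hnorm']; norm_num) hY2.ge
    rw [h1]
    exact abs_sq_sub_two_mul_le hY0 hYH hH1 (h2.trans_eq (one_mul Y))
  have hqr : |q - r| ≤ 10 ^ 7 * H := by
    obtain ⟨s, hs, hwin⟩ := h.exists_window hV hxJ hμ hK hb hbK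
    have h1 := h.amplitude_le hV hJm hxm hμ hK hb hbK hm
    have h2 : 1 ≤ 71680 * K ^ 6 * b ^ 2 * ∑ i ∈ s, x i ^ 2 := by
      have h3 : 1 ≤ 160 * K ^ 3 * b ^ 3 * (14 * K ^ 2 * x J ^ 2) :=
        hamp.trans (mul_le_mul_of_nonneg_left h1 (by positivity))
      have h4 := mul_le_mul_of_nonneg_left hwin (by positivity : 0 ≤ 2240 * K ^ 5 * b ^ 2)
      linarith
    have h3 := hle s hs
    have h4 : ∑ j ∈ s, y j ^ 2 ≤ Y ^ 2 := by
      rw [hY2]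
      exact sum_le_sum_of_subset_of_nonneg (hs.trans (range_subset_range.2 (by omega)))
        fun j _ _ => sq_nonneg _
    have h5 : Y ^ 2 ≤ (6000 * K ^ 4 * E) ^ 2 := pow_le_pow_left₀ hY0 hYle 2
    have h6 : K ^ 2 * E ^ 2 ≤ (K ^ 4 * E) ^ 2 := by
      rw [mul_pow (K ^ 4) E]
      refine mul_le_mul_of_nonneg_right ?_ (sq_nonneg _)
      rw [← pow_mul]
      exact pow_le_pow_right₀ (by linarith) (by norm_num)
    have h7 : (q - r) ^ 2 * ∑ j ∈ s, x j ^ 2 ≤ 72000008 * (K ^ 4 * E) ^ 2 := by linarith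
    have h8 : (q - r) ^ 2 ≤ (10 ^ 7 * H) ^ 2 := by
      calc (q - r) ^ 2 ≤ (q - r) ^ 2 * (71680 * K ^ 6 * b ^ 2 * ∑ i ∈ s, x i ^ 2) :=
            le_mul_of_one_le_right (sq_nonneg _) h2
        _ = 71680 * K ^ 6 * b ^ 2 * ((q - r) ^ 2 * ∑ i ∈ s, x i ^ 2) := by ring
        _ ≤ 71680 * K ^ 6 * b ^ 2 * (72000008 * (K ^ 4 * E) ^ 2) :=
            mul_le_mul_of_nonneg_left h7 (by positivity)
        _ = 71680 * 72000008 * H ^ 2 := by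
            rw [hH, hE]
            ring
        _ ≤ _ := by
            have := sq_nonneg H
            linarith
    exact abs_le_of_sq_le_sq h8 (by positivity)
  have hq1 : |q - 1| ≤ 2 * 10 ^ 7 * H := abs_sub_one_le_of_abs_sub_le hq hH0 hH1 hqr hr2
  have hxj := h.nonneg hj
  have h1 := hqx j hj
  have h2 : K * ε * b ^ 3 ≤ H := by
    have h3 : K ≤ K ^ 4 := by
      calc K = K ^ 1 := (pow_one K).symm
        _ ≤ _ := pow_le_pow_right₀ (by linarith) (by norm_num)
    calc _ = K * E := by rw [hE]; ring
      _ ≤ K ^ 4 * E := mul_le_mul_of_nonneg_right h3 hE0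
      _ ≤ H := hKEH
  have hq2 := abs_le.1 hq1
  have h3 : K * ε * b ^ 3 * (q * x j) ≤ H * (2 * x j) :=
    mul_le_mul h2 (mul_le_mul_of_nonneg_right (by linarith) hxj) (by positivity) hH0
  have e : 10 ^ 8 * K ^ 7 * ε * b ^ 4 * x j = 10 ^ 8 * (H * x j) := by
    rw [hH]
    ring
  rw [e]
  calc |x' j - x j| = |(x' j - q * x j) + (q - 1) * x j| := by congr 1; ring
    _ ≤ |x' j - q * x j| + |(q - 1) * x j| := abs_add_le _ _
    _ ≤ H * (2 * x j) + 2 * 10 ^ 7 * H * x j := by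
        refine add_le_add (h1.trans h3) ?_
        rw [abs_mul, abs_of_nonneg hxj]
        exact mul_le_mul_of_nonneg_right hq1 hxj
    _ ≤ _ := by
        have := mul_nonneg hH0 hxj
        linarith

end IsTurn

/-- The potential `j ↦ (j / c) ^ a`. -/
noncomputable def powerPotential (a c : ℝ) (j : ℕ) : ℝ := ((j : ℝ) / c) ^ a

theorem diagEntry_eq (a c : ℝ) (j : ℕ) : diagEntry a c j = 2 + powerPotential a c j := rfl

theorem one_add_rpow_le {a t : ℝ} (ha : 1 ≤ a) (ht0 : 0 ≤ t) (ht1 : t ≤ 1) :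
    (1 + t) ^ a ≤ 1 + t * 2 ^ a := by
  have h := (convexOn_rpow ha).2 (show (1 : ℝ) ∈ Set.Ici 0 by simp)
    (show (2 : ℝ) ∈ Set.Ici 0 by simp) (sub_nonneg.2 ht1) ht0 (by ring)
  simp only [smul_eq_mul, Real.one_rpow] at h
  have e : (1 - t) * 1 + t * 2 = 1 + t := by ring
  rw [e] at h
  linarith

theorem isProfile_powerPotential {a c K : ℝ} (ha : 1 ≤ a) (hc : 0 < c) (hK : 2 ^ a ≤ K) :
    IsProfile (powerPotential a c) K := by
  have hpos : ∀ j, 1 ≤ j → 0 < powerPotential a c j := by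
    intro j hj
    have : (0 : ℝ) < j := by exact_mod_cast hj
    unfold powerPotential
    positivity
  refine ⟨?_, hpos, ?_, ?_, ?_⟩
  · simp [powerPotential, Real.zero_rpow (by linarith : a ≠ 0)]
  · intro i j hij
    rcases Nat.eq_zero_or_pos i with rfl | hi
    · simp [powerPotential, Real.zero_rpow (by linarith : a ≠ 0)]
    have hi0 : (0 : ℝ) < i := by exact_mod_cast hi
    have hj0 : (0 : ℝ) < j := by exact_mod_cast (by omega : 0 < j)
    have hij' : (i : ℝ) ≤ j := by exact_mod_cast hij
    have e : ∀ k : ℕ, (0 : ℝ) < k → powerPotential a c k = k * ((k / c) ^ (a - 1) / c) := by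
      intro k hk
      unfold powerPotential
      rw [Real.rpow_sub_one (by positivity)]
      field_simp
    rw [e i hi0, e j hj0]
    have h1 : (i / c : ℝ) ^ (a - 1) ≤ (j / c) ^ (a - 1) :=
      Real.rpow_le_rpow (by positivity) (by gcongr) (by linarith)
    have h2 : (i / c : ℝ) ^ (a - 1) / c ≤ (j / c) ^ (a - 1) / c := by gcongr
    have h3 := mul_le_mul_of_nonneg_left h2 (by positivity : (0 : ℝ) ≤ i * j)
    linarith
  · intro j hj
    have hj0 : (0 : ℝ) < j := by exact_mod_cast hj
    have h1 : powerPotential a c (j + 1) = (1 + 1 / j) ^ a * powerPotential a c j := by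
      unfold powerPotential
      rw [← Real.mul_rpow (by positivity) (by positivity)]
      congr 1
      push_cast
      field_simp
    have h2 := one_add_rpow_le ha (by positivity : (0 : ℝ) ≤ 1 / j)
      (by rw [div_le_one hj0]; exact_mod_cast hj)
    have h3 := mul_le_mul_of_nonneg_right h2 (hpos j hj).le
    rw [h1]
    have h4 := mul_le_mul_of_nonneg_right hK (hpos j hj).le
    have h5 : (j : ℝ) * (1 / j * 2 ^ a * powerPotential a c j) = 2 ^ a * powerPotential a c j := by
      field_simp
    have h6 := mul_le_mul_of_nonneg_left h3 hj0.le
    linarith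
  · intro i j hij
    have h1 : powerPotential a c j ≤ 2 ^ a * powerPotential a c i := by
      unfold powerPotential
      rw [← Real.mul_rpow (by positivity) (by positivity)]
      refine Real.rpow_le_rpow (by positivity) ?_ (by linarith)
      rw [← mul_div_assoc]
      have : (j : ℝ) ≤ 2 * i := by exact_mod_cast hij
      gcongr
    rcases Nat.eq_zero_or_pos i with rfl | hi
    · have e : powerPotential a c 0 = 0 := by
        simp [powerPotential, Real.zero_rpow (by linarith : a ≠ 0)]
      rw [e] at h1 ⊢
      linarith
    · exact h1.trans (mul_le_mul_of_nonneg_right hK (hpos i hi).le)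

/-- Where the potential is at most `B`, its mean slope is at most `B / c`. -/
theorem powerPotential_mul_le {a c B : ℝ} (ha : 1 ≤ a) (hc : 0 < c) (hB : 1 ≤ B) {j : ℕ}
    (hj : powerPotential a c j ≤ B) : c * powerPotential a c j ≤ B * j := by
  rcases Nat.eq_zero_or_pos j with rfl | hj1
  · simp [powerPotential, Real.zero_rpow (by linarith : a ≠ 0)]
  have hj0 : (0 : ℝ) < j := by exact_mod_cast hj1
  rcases le_or_gt ((j : ℝ) / c) 1 with h | h
  · have h1 : powerPotential a c j ≤ j / c :=
      (Real.rpow_le_rpow_of_exponent_ge (by positivity) h ha).trans_eq (Real.rpow_one _)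
    have h2 := mul_le_mul_of_nonneg_left h1 hc.le
    have h3 : c * (j / c) = j := by field_simp
    nlinarith
  · rw [one_lt_div hc] at h
    have h1 : 0 ≤ powerPotential a c j := by
      unfold powerPotential
      positivity
    nlinarith

theorem exists_cube_mul_eq {v w : ℝ} (hv : 0 < v) (hw : 0 < w) : ∃ b : ℝ, 0 < b ∧ b ^ 3 * v = w := by
  refine ⟨(w / v) ^ (1 / 3 : ℝ), by positivity, ?_⟩
  rw [← Real.rpow_natCast, ← Real.rpow_mul (by positivity)]
  norm_num
  field_simp

theorem pow_four_le_rpow {a b c : ℝ} {J : ℕ} (ha : 1 ≤ a) (hc : 0 < c) (hb0 : 0 < b) (hbJ : b ≤ J)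
    (hb : b ^ 3 * powerPotential a c J = J) : b ^ 4 ≤ c ^ (4 * a / (a + 2)) := by
  have hJ : (0 : ℝ) < J := hb0.trans_le hbJ
  have h1 : b ^ 3 * (J : ℝ) ^ (a - 1) = c ^ a := by
    unfold powerPotential at hb
    rw [Real.div_rpow hJ.le hc.le] at hb
    rw [Real.rpow_sub_one hJ.ne']
    have : 0 < c ^ a := by positivity
    field_simp at hb ⊢
    linarith
  have h2 : b ^ (a + 2) ≤ c ^ a := by
    have e : b ^ (a + 2) = b ^ 3 * b ^ (a - 1) := by
      rw [← Real.rpow_natCast b 3, ← Real.rpow_add hb0]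
      congr 1
      push_cast
      ring
    rw [e, ← h1]
    exact mul_le_mul_of_nonneg_left (Real.rpow_le_rpow hb0.le hbJ (by linarith)) (by positivity)
  have h3 := Real.rpow_le_rpow (by positivity) h2 (by positivity : (0 : ℝ) ≤ 4 / (a + 2))
  rw [← Real.rpow_mul hb0.le, ← Real.rpow_mul hc.le] at h3
  have e1 : (a + 2) * (4 / (a + 2)) = (4 : ℕ) := by
    push_cast
    field_simp
  have e2 : a * (4 / (a + 2)) = 4 * a / (a + 2) := by ring
  rw [e1, e2, Real.rpow_natCast] at h3
  exact h3

namespace IsTurn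

variable {V x : ℕ → ℝ} {μ K : ℝ} {J : ℕ}

/-- An a priori bound for the potential at the stopping index. -/
theorem apply_le (h : IsTurn V μ x J) (hV : IsProfile V K) (hK : 2 ≤ K)
    (hμK : μ ≤ K) : V J ≤ 3 * K ^ 2 := by
  have hJ := h.two_le
  obtain ⟨i, rfl⟩ : ∃ i, J = i + 1 := ⟨J - 1, by omega⟩
  have hi : 1 ≤ i := by omega
  have h1 := hV.le_of_le_two_mul i (i + 1) (by omega)
  have h2 : V i ≤ 3 * K := by
    rcases h.before i hi (by omega) with h3 | h3
    · linarith
    · by_contra! h4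
      have h5 := hV.nonneg i
      have h6 : (V i / i) ^ 2 ≤ V i ^ 2 := by
        refine pow_le_pow_left₀ (by positivity) (div_le_self h5 ?_) 2
        exact_mod_cast hi
      have h7 : V i ≤ 3 / 2 * (V i - μ) := by linarith
      have h8 : V i ^ 2 ≤ (3 / 2 * (V i - μ)) ^ 2 := pow_le_pow_left₀ h5 h7 2
      have h9 : 4 * (V i - μ) ^ 2 ≤ (V i - μ) ^ 3 := by
        have : 0 ≤ (V i - μ - 4) * (V i - μ) ^ 2 := mul_nonneg (by linarith) (sq_nonneg _)
        linarith
      nlinarith [sq_nonneg (V i - μ)]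
  nlinarith

end IsTurn

/-- The index where the middle of the oscillatory range is reached, or the last index. -/
theorem IsProfile.exists_middle {V : ℕ → ℝ} {μ K : ℝ} {J n : ℕ} (hV : IsProfile V K)
    (hJn : J ≤ n) (hJ : V J ≤ μ + 2) (hJ1 : 1 ≤ J)
    (hstep : ∀ j, V j ≤ μ + 2 → 1 ≤ j → V (j + 1) - V j ≤ 1 / 2) :
    ∃ m, J ≤ m ∧ m ≤ n ∧ V m ≤ μ + 2 ∧ (m = n ∨ μ + 3 / 2 ≤ V m) := by
  classical
  by_cases hn : V n ≤ μ + 2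
  · exact ⟨n, hJn, le_rfl, hn, Or.inl rfl⟩
  push Not at hn
  have hex : ∃ j, μ + 2 < V (j + 1) := ⟨n, hn.trans_le (hV.monotone (Nat.le_succ n))⟩
  have h1 := Nat.find_spec hex
  have hJm : J ≤ Nat.find hex := by
    by_contra! h
    linarith [hV.monotone (by omega : Nat.find hex + 1 ≤ J)]
  have hm : V (Nat.find hex) ≤ μ + 2 := by
    obtain ⟨i, hi⟩ : ∃ i, Nat.find hex = i + 1 := ⟨Nat.find hex - 1, by omega⟩
    have := Nat.find_min hex (by omega : i < Nat.find hex)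
    rw [hi]
    linarith
  refine ⟨Nat.find hex, hJm, ?_, hm, Or.inr ?_⟩
  · exact Nat.find_min' hex (hn.trans_le (hV.monotone (Nat.le_succ n)))
  · linarith [hstep _ hm (by omega)]

/-- The residual of an eigenvector of a perturbed Jacobi matrix in the unperturbed recurrence. -/
theorem abs_residual_le {u v w A d e e' lam lam' ε : ℝ} (hA : 0 ≤ A) (hlam : 0 ≤ lam)
    (hε : 0 ≤ ε) (h : e' * w + e * u + d * v = lam' * v) (he : |e - 1| ≤ ε) (he' : |e' - 1| ≤ ε)
    (hd : |d - A| ≤ ε * A) (hl : |lam' - lam| ≤ ε * (lam + 4)) :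
    |w + u - (lam - A) * v| ≤ ε * (lam + 4 + A) * (|w| + |v| + |u|) := by
  have e1 : w + u - (lam - A) * v =
      -((e' - 1) * w) + -((e - 1) * u) + ((lam' - lam) * v + -((d - A) * v)) := by
    linear_combination h
  rw [e1]
  have h1 : |(e' - 1) * w| ≤ ε * |w| := by
    rw [abs_mul]
    exact mul_le_mul_of_nonneg_right he' (abs_nonneg _)
  have h2 : |(e - 1) * u| ≤ ε * |u| := by
    rw [abs_mul]
    exact mul_le_mul_of_nonneg_right he (abs_nonneg _)
  have h3 : |(lam' - lam) * v| ≤ ε * (lam + 4) * |v| := by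
    rw [abs_mul]
    exact mul_le_mul_of_nonneg_right hl (abs_nonneg _)
  have h4 : |(d - A) * v| ≤ ε * A * |v| := by
    rw [abs_mul]
    exact mul_le_mul_of_nonneg_right hd (abs_nonneg _)
  have h5 : |-((e' - 1) * w) + -((e - 1) * u) + ((lam' - lam) * v + -((d - A) * v))| ≤
      |(e' - 1) * w| + |(e - 1) * u| + (|(lam' - lam) * v| + |(d - A) * v|) := by
    refine (abs_add_le _ _).trans (add_le_add ((abs_add_le _ _).trans ?_)
      ((abs_add_le _ _).trans ?_))
    · rw [abs_neg, abs_neg]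
    · rw [abs_neg]
  have h6 : 0 ≤ ε * (lam + 3 + A) * (|w| + |u|) := by positivity
  linarith

/-- The residual of an eigenvector with nonnegative entries in the perturbed recurrence. -/
theorem abs_perturbed_residual_le {u v w A d e e' lam lam' ε : ℝ} (hu : 0 ≤ u) (hv : 0 ≤ v)
    (hw : 0 ≤ w) (h : w + u = (lam - A) * v) (he : |e - 1| ≤ ε)
    (he' : |e' - 1| ≤ ε) (hd : |d - A| ≤ ε * A) (hl : |lam' - lam| ≤ ε * (lam + 4)) :
    |(lam' - d) * v - e' * w - e * u| ≤ ε * (2 * lam + 4) * v := by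
  have h1 := mul_le_mul_of_nonneg_right (abs_le.1 he).1 hu
  have h2 := mul_le_mul_of_nonneg_right (abs_le.1 he).2 hu
  have h3 := mul_le_mul_of_nonneg_right (abs_le.1 he').1 hw
  have h4 := mul_le_mul_of_nonneg_right (abs_le.1 he').2 hw
  have h5 := mul_le_mul_of_nonneg_right (abs_le.1 hd).1 hv
  have h6 := mul_le_mul_of_nonneg_right (abs_le.1 hd).2 hv
  have h7 := mul_le_mul_of_nonneg_right (abs_le.1 hl).1 hv
  have h8 := mul_le_mul_of_nonneg_right (abs_le.1 hl).2 hv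
  have h9 : ε * w + ε * u = ε * (lam - A) * v := by linear_combination ε * h
  rw [abs_le]
  constructor <;> linarith

set_option maxHeartbeats 1000000 in
/-- The bound of the main theorem with explicit constants. -/
theorem IsNormalizedEigenvector.abs_sub_le {a L K M c lam lam' ε : ℝ} (ha : 1 ≤ a)
    (hK : K = 2 ^ a + |L| + 6) (hM : M = 24 * (2 * K + 4) ^ 2 * K ^ 2) (hc : 3 * K ^ 2 * M ^ 3 ≤ c)
    {n k : ℕ} (hk1 : 1 ≤ k) (hkn : k ≤ n) {X X' : Fin n → ℝ}
    (hX : IsNormalizedEigenvector (tridiag a c n) lam X) (hklam : 2 + diagEntry a c k < lam)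
    (hlamL : lam ≤ L) (hε : 0 < ε) (hε2 : ε ≤ 1 / 2)
    (hsmall : 10 ^ 8 * M ^ 7 * ε * c ^ (4 * a / (a + 2)) ≤ 1)
    {A' : Matrix (Fin n) (Fin n) ℝ} {d e : ℕ → ℝ} (hA' : IsJacobi A' d e)
    (hd : ∀ j, |d j - diagEntry a c j| ≤ ε * diagEntry a c j) (he : ∀ j, |e j - 1| ≤ ε)
    (hX' : IsNormalizedEigenvector A' lam' X') (hlam' : |lam' - lam| ≤ ε * (lam + 4))
    (j : Fin n) (hj : (j : ℕ) < k) :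
    X j ≠ 0 ∧ |(X' j - X j) / X j| ≤ ε * (10 ^ 8 * M ^ 7 * c ^ (4 * a / (a + 2))) := by
  have h2a : (0 : ℝ) < 2 ^ a := by positivity
  have hL := le_abs_self L
  have hK6 : 6 ≤ K := by rw [hK]; linarith [abs_nonneg L]
  have hKM : 24 * K ≤ M := by
    rw [hM]
    have h1 : 1 ≤ (2 * K + 4) ^ 2 := one_le_pow₀ (by linarith)
    have h2 : K ≤ K ^ 2 := by nlinarith
    nlinarith
  have hM1 : 1 ≤ M := by linarith
  have hM3 : 1 ≤ M ^ 3 := one_le_pow₀ hM1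
  have hc2 : 3 * K ^ 2 ≤ c := le_trans (le_mul_of_one_le_right (by positivity) hM3) hc
  have hc0 : 0 < c := lt_of_lt_of_le (by positivity) hc2
  obtain ⟨μ, hμdef⟩ : ∃ μ, μ = lam - 4 := ⟨_, rfl⟩
  set V := powerPotential a c with hVdef
  have hV : IsProfile V K := isProfile_powerPotential ha hc0 (by rw [hK]; linarith [abs_nonneg L])
  have hVM : IsProfile V M :=
    isProfile_powerPotential ha hc0 (by linarith [abs_nonneg L])
  have hVk : V k < μ := by
    rw [diagEntry_eq] at hklam
    linarith
  have hμ0 : 0 ≤ μ := (hV.nonneg k).trans hVk.le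
  have hμK : 3 + μ ≤ K := by linarith
  have hμM : 3 + μ ≤ M := by linarith
  set x := zeroExtend X with hxdef
  set x' := zeroExtend X' with hx'def
  have hx1 : 0 < x 1 := by
    have h1 := zeroExtend_succ X ⟨0, by omega⟩
    have h2 := hX.first_pos ⟨0, by omega⟩ rfl
    rw [← h1] at h2
    exact h2
  have hx'1 : 0 < x' 1 := by
    have h1 := zeroExtend_succ X' ⟨0, by omega⟩
    have h2 := hX'.first_pos ⟨0, by omega⟩ rfl
    rw [← h1] at h2
    exact h2
  have hxn : x (n + 1) = 0 := zeroExtend_of_lt X (by omega)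
  have hx'n : x' (n + 1) = 0 := zeroExtend_of_lt X' (by omega)
  have hx : SolvesUpTo V μ x 0 n := by
    intro i hi
    have h1 := (isJacobi_tridiag a c n).recurrence hX.mulVec_eq hi
    rw [diagEntry_eq] at h1
    simp only [Pi.zero_apply, add_zero]
    rw [hμdef]
    linear_combination h1
  have hx'rec := fun i (hi : i < n) => hA'.recurrence hX'.mulVec_eq hi
  obtain ⟨J, hJ, hkJ, hJn⟩ := exists_isTurn hV.monotone (zeroExtend_zero X) hx1 hxn hx hk1 hkn hVk
  have hJ2 := hJ.two_le
  have hxJ : SolvesUpTo V μ x 0 J := fun i hi => hx i (by omega)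
  have hJpos : (0 : ℝ) < J := by exact_mod_cast (by omega : 0 < J)
  obtain ⟨b, hb0, hb⟩ := exists_cube_mul_eq (hV.pos J (by omega)) hJpos
  have hbJ := hJ.scale_le hV hxJ hμ0 hb
  have hbM : M ≤ b := by
    have h1 := powerPotential_mul_le ha hc0 (by nlinarith : 1 ≤ 3 * K ^ 2)
      (hJ.apply_le hV (by linarith) (by linarith))
    have h2 : c ≤ 3 * K ^ 2 * b ^ 3 := by
      refine le_of_mul_le_mul_right ?_ (hV.pos J (by omega))
      rw [mul_assoc, hb]
      exact h1
    have h3 : M ^ 3 ≤ b ^ 3 := by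
      refine le_of_mul_le_mul_left (hc.trans h2) (by positivity)
    exact le_of_pow_le_pow_left₀ (by norm_num) hb0.le h3
  have hb1 : 1 ≤ b := hM1.trans hbM
  have hVJ : V J ≤ μ + 2 := by
    have h1 := hJ.excess_le hV (by linarith) hb hb1
    have h2 : b ^ 2 * (V J - μ) ≤ b ^ 2 * 2 := by nlinarith
    have h3 := le_of_mul_le_mul_left h2 (by positivity)
    linarith
  obtain ⟨m, hJm, hmn, hm, hm'⟩ := hV.exists_middle hJn hVJ (by omega) fun i hi hi1 => by
    have h1 := hV.step_le i hi1
    have h2 := powerPotential_mul_le ha hc0 (by linarith : 1 ≤ K) (hi.trans (by linarith))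
    have hi0 : (0 : ℝ) < i := by exact_mod_cast hi1
    refine le_of_mul_le_mul_left ?_ (by positivity : 0 < c * i)
    have h3 := mul_le_mul_of_nonneg_left h1 hc0.le
    have h4 := mul_le_mul_of_nonneg_left h2 (by linarith : 0 ≤ K)
    have h5 := mul_le_mul_of_nonneg_right hc2 hi0.le
    nlinarith
  -- near proportionality on the initial stretch
  set q := x' 1 / x 1 with hq
  have hq0 : 0 < q := by positivity
  have hb4 := pow_four_le_rpow ha hc0 hb0 hbJ hb
  have hsmall' : 10 ^ 8 * M ^ 7 * ε * b ^ 4 ≤ 1 :=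
    (mul_le_mul_of_nonneg_left hb4 (by positivity)).trans hsmall
  have hprop : ∀ i ≤ J, |x' i - q * x i| ≤ M * ε * b ^ 3 * (q * x i) := by
    intro i hi
    have hT := hJ.sum_weights_le hV hb (by linarith : 1 ≤ K) (hVJ.trans (by linarith))
    have e1 : 4 * (3 * K * ε) * (2 * (2 * K + 4) ^ 2 * K * b ^ 3) = M * ε * b ^ 3 := by
      rw [hM]
      ring
    rw [← e1]
    refine hJ.abs_sub_le (d := d) (e := e) (lam := lam') (zeroExtend_zero X') hx'1
      (fun i hi => hx'rec i (by omega))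
      (fun i => by linarith [(abs_le.1 (he i)).1]) (by positivity) ?_
      (fun i => by positivity) (fun i hi => hJ.sum_sq_le hV hxJ (by linarith) hb hb1 hi) hT ?_ hi
    · intro i hi
      have h1 := hx i (by omega)
      simp only [Pi.zero_apply, add_zero] at h1
      have hdi := hd (i + 1)
      have h2 : x (i + 2) + x i = (lam - diagEntry a c (i + 1)) * x (i + 1) := by
        rw [h1, diagEntry_eq, hμdef]
        ring
      have h3 := hJ.nonneg (by omega : i + 1 ≤ J)
      refine (abs_perturbed_residual_le (hJ.nonneg (by omega)) h3 (hJ.nonneg (by omega)) h2 (he i)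
        (he (i + 1)) hdi hlam').trans (mul_le_mul_of_nonneg_right ?_ h3)
      have h4 : 2 * lam + 4 ≤ 3 * K := by linarith
      have h5 := mul_le_mul_of_nonneg_left h4 hε.le
      linarith
    · rw [e1]
      have h1 : M * ε * b ^ 3 ≤ M ^ 7 * ε * b ^ 4 := by
        gcongr
        · calc M = M ^ 1 := (pow_one M).symm
            _ ≤ _ := pow_le_pow_right₀ hM1 (by norm_num)
        · norm_num
      have h2 : 0 ≤ M ^ 7 * ε * b ^ 4 := by positivity
      linarith
  have hnorm : ∑ i ∈ range (n + 1), x i ^ 2 = 1 :=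
    (sum_range_zeroExtend_sq X).trans hX.unit_length
  have hnorm' : ∑ i ∈ range (n + 1), x' i ^ 2 = 1 :=
    (sum_range_zeroExtend_sq X').trans hX'.unit_length
  have hmain := hJ.abs_sub_le_of_proportional hVM (x' := x')
    (f := fun i => x' (i + 1) + x' (i - 1) - (2 + μ - V i) * x' i)
    (by linarith) hμ0 hμM hbM hb hJm hmn hm hm' hxn hx hnorm (zeroExtend_zero X') hx'n
    (fun i _ => by simp) hnorm' hε.le (fun i hi => by
      have h1 := abs_residual_le (A := 2 + V (i + 1)) (by linarith [hV.nonneg (i + 1)])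
        (by linarith) hε.le (hx'rec i hi) (he i) (he (i + 1)) (hd (i + 1)) hlam'
      have e1 : lam - (2 + V (i + 1)) = 2 + μ - V (i + 1) := by rw [hμdef]; ring
      rw [e1] at h1
      simp only [Nat.add_sub_cancel]
      refine h1.trans (mul_le_mul_of_nonneg_right (mul_le_mul_of_nonneg_left ?_ hε.le)
        (by positivity))
      linarith) hq0 hprop hsmall' (j := (j : ℕ) + 1) (by omega)
  have hXj := hJ.pos (by omega : 1 ≤ (j : ℕ) + 1) (by omega : (j : ℕ) + 1 ≤ J)
  simp only [hx'def, zeroExtend_succ] at hmain hXj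
  refine ⟨hXj.ne', ?_⟩
  rw [abs_div, abs_of_pos hXj, div_le_iff₀ hXj]
  refine hmain.trans (mul_le_mul_of_nonneg_right ?_ hXj.le)
  calc _ ≤ 10 ^ 8 * M ^ 7 * ε * c ^ (4 * a / (a + 2)) :=
        mul_le_mul_of_nonneg_left hb4 (by positivity)
    _ = _ := by ring

theorem mainTheorem1 (a L : ℝ) (ha : 1 ≤ a) :
    ∃ C c₀ : ℝ, 0 < C ∧ 1 ≤ c₀ ∧
      ∀ c : ℝ, c₀ ≤ c →
      ∀ n k : ℕ, 1 ≤ k → k ≤ n →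
      ∀ (lam : ℝ) (X : Fin n → ℝ), IsNormalizedEigenvector (tridiag a c n) lam X →
        2 + diagEntry a c k < lam → lam ≤ L →
      ∀ ε : ℝ, 0 < ε → C * ε * c ^ (4 * a / (a + 2)) ≤ 1 →
      ∀ A' : Matrix (Fin n) (Fin n) ℝ, A'.IsSymm → EntriesAgreeTo ε (tridiag a c n) A' →
        (∃ (lam' : ℝ) (X' : Fin n → ℝ),
          CorrespondingEigenvalues (tridiag a c n) A' lam lam' ∧
          IsNormalizedEigenvector A' lam' X') ∧
        ∀ (lam' : ℝ) (X' : Fin n → ℝ),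
          CorrespondingEigenvalues (tridiag a c n) A' lam lam' →
          IsNormalizedEigenvector A' lam' X' →
          ∀ j : Fin n, (j : ℕ) < k →
            X j ≠ 0 ∧ |(X' j - X j) / X j| ≤ ε * (C * c ^ (4 * a / (a + 2))) := by
  obtain ⟨K, hK⟩ : ∃ K, K = 2 ^ a + |L| + 6 := ⟨_, rfl⟩
  obtain ⟨M, hM⟩ : ∃ M, M = 24 * (2 * K + 4) ^ 2 * K ^ 2 := ⟨_, rfl⟩
  have hK6 : 6 ≤ K := by
    have : (0 : ℝ) < 2 ^ a := by positivity
    rw [hK]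
    linarith [abs_nonneg L]
  have hM1 : 1 ≤ M := by
    have h1 : 1 ≤ (2 * K + 4) ^ 2 := one_le_pow₀ (by linarith)
    have h2 : 1 ≤ K ^ 2 := one_le_pow₀ (by linarith)
    have h3 := mul_le_mul h1 h2 zero_le_one (by positivity)
    rw [hM]
    linarith
  have hM7 : 1 ≤ M ^ 7 := one_le_pow₀ hM1
  have hc1 : 1 ≤ 3 * K ^ 2 * M ^ 3 := by
    have h1 : 1 ≤ M ^ 3 := one_le_pow₀ hM1
    have h2 : 1 ≤ K ^ 2 := one_le_pow₀ (by linarith)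
    have h3 := mul_le_mul h2 h1 zero_le_one (by positivity)
    linarith
  refine ⟨10 ^ 8 * M ^ 7, 3 * K ^ 2 * M ^ 3, by positivity, hc1, ?_⟩
  intro c hc n k hk1 hkn lam X hX hklam hlamL ε hε hsmall A' hsymm hagree
  have hc0 : 0 ≤ c := by linarith
  have hpow : 1 ≤ c ^ (4 * a / (a + 2)) := Real.one_le_rpow (hc1.trans hc) (by positivity)
  have hε2 : ε ≤ 1 / 2 := by
    have h1 : 2 * 1 * ε * 1 ≤ 10 ^ 8 * M ^ 7 * ε * c ^ (4 * a / (a + 2)) := by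
      gcongr
      norm_num
    linarith
  obtain ⟨d, e, hA', hd, he⟩ := hagree.exists_isJacobi hc0 hε.le hsymm
  have he0 : ∀ j, e j ≠ 0 := fun j h => by
    have := (abs_le.1 (he j)).1
    rw [h] at this
    linarith
  constructor
  · have hM : (tridiag a c n).IsHermitian := by
      rw [Matrix.IsHermitian, Matrix.conjTranspose_eq_transpose_of_trivial]
      exact isSymm_tridiag a c n
    have hN : A'.IsHermitian := by
      rw [Matrix.IsHermitian, Matrix.conjTranspose_eq_transpose_of_trivial]
      exact hsymm
    have hX0 : X ≠ 0 := by
      rintro rfl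
      simpa using hX.unit_length
    obtain ⟨i, hi⟩ := hM.exists_eigenvalues₀_eq hX.mulVec_eq hX0
    obtain ⟨X', hX'⟩ := hA'.exists_isNormalizedEigenvector he0 hN i
    exact ⟨_, X', ⟨hM, hN, i, hi, rfl⟩, hX'⟩
  · intro lam' X' hcorr hX' j hj
    exact hX.abs_sub_le ha hK hM hc hk1 hkn hklam hlamL hε hε2 hsmall hA' hd he hX'
      (abs_sub_le_of_correspondingEigenvalues hc0 hε.le (by linarith) hagree hcorr) j hj
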